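/- Let $D=2n$ and let $\Theta=\theta\,\mathrm{diag}(J,\dots,J)$ be the $D\times D$ skew-symmetric matrix with $n$ blocks $J=\begin{pmatrix}0&-1\\1&0\end{pmatrix}$, where $\theta$ is a nonzero real number. Let $\mathcal S$ be the space of complex-valued Schwartz functions on $\mathbb R^D$ and $\mathcal S'$ the space of tempered distributions. For $a,b\in\mathcal S$ let $$(a\star b)(x)=\frac1{(\pi\theta)^D}\int d^Dy\,d^Dz\;a(x+y)\,b(x+z)\,e^{-2i\,y\Theta^{-1}z}\in\mathcal S .$$ For $T\in\mathcal S'$ and $a\in\mathcal S$ define $T\star a,\ a\star T\in\mathcal S'$ by $\langle T\star a,b\rangle=\langle T,a\star b\rangle$ and $\langle a\star T,b\rangle=\langle T,b\star a\rangle$ for $b\in\mathcal S$. The Moyal algebra is $\mathcal M=\{T\in\mathcal S' : T\star a\in\mathcal S\text{ and }a\star T\in\mathcal S\text{ for all }a\in\mathcal S\}$, with the product $\langle S\star T,a\rangle=\langle S,T\star a\rangle$ for $S,T\in\mathcal M$, $a\in\mathcal S$, and the Moyal bracket $[S,T]_\star=S\star T-T\star S$. Let $\mathcal P_2$ be the complex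 vector space of polynomial functions on $\mathbb R^D$ with complex coefficients and of degree at most $2$, regarded as tempered distributions, and for polynomial functions $a,b$ let $\{a,b\}_{PB}=\sum_{\mu,\nu}\Theta_{\mu\nu}\frac{\partial a}{\partial x_\mu}\frac{\partial b}{\partial x_\nu}$ be the Poisson bracket for $\Theta$. Then $\mathcal P_2\subset\mathcal M$; for $P_1,P_2\in\mathcal P_2$ the product $P_1\star P_2$ lies in $\mathcal M$; $\mathcal P_2$ is closed under $[\cdot,\cdot]_\star$ and is, with this bracket, a complex Lie algebra (the bracket is bilinear and alternating and satisfies the Jacobi identity); and $$[P_1,P_2]_\star=i\,\{P_1,P_2\}_{PB}\qquad\text{for all }P_1,P_2\in\mathcal P_2 .$$ -/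

import Mathlib

open scoped SchwartzMap

namespace Moyal

section Auxiliary

variable {V : Type*} [NormedAddCommGroup V] [InnerProductSpace ℝ V]

theorem norm_iteratedFDeriv_comp_le {W : Type*} [NormedAddCommGroup W] [NormedSpace ℝ W]
    (f : 𝓢(V, ℂ)) (L : W →L[ℝ] V) (hL : ‖L‖ ≤ 1) (i : ℕ) (x : W) :
    ‖iteratedFDeriv ℝ i (fun z => f (L z)) x‖ ≤ ‖iteratedFDeriv ℝ i f (L x)‖ := by
  have h := L.iteratedFDeriv_comp_right (f := f) (n := i) (f.smooth i) x (i := i) le_rfl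
  change ‖iteratedFDeriv ℝ i (f ∘ L) x‖ ≤ _
  rw [h]
  refine (ContinuousMultilinearMap.norm_compContinuousLinearMap_le _ _).trans ?_
  refine mul_le_of_le_one_right (norm_nonneg _) ?_
  simpa using pow_le_one₀ (norm_nonneg L) hL

theorem norm_pow_le_prod {V : Type*} [NormedAddCommGroup V] (x : WithLp 2 (V × V)) (k : ℕ) :
    ‖x‖ ^ k ≤ 2 ^ k * (‖x.fst‖ ^ k + ‖x.snd‖ ^ k) := by
  have h : ‖x‖ ≤ ‖x.fst‖ + ‖x.snd‖ := by
    refine abs_le_of_sq_le_sq' ?_ (by positivity) |>.2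
    rw [WithLp.prod_norm_sq_eq_of_L2]
    nlinarith [norm_nonneg x.fst, norm_nonneg x.snd]
  rcases le_total ‖x.fst‖ ‖x.snd‖ with h1 | h1
  · calc ‖x‖ ^ k ≤ (2 * ‖x.snd‖) ^ k := by gcongr; linarith
      _ ≤ _ := by rw [mul_pow]; gcongr; simp
  · calc ‖x‖ ^ k ≤ (2 * ‖x.fst‖) ^ k := by gcongr; linarith
      _ ≤ _ := by rw [mul_pow]; gcongr; simp

theorem contDiff_tensor (f g : 𝓢(V, ℂ)) (n : ℕ∞) :
    ContDiff ℝ n (fun z : WithLp 2 (V × V) => f z.fst * g z.snd) := by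
  refine ContDiff.mul ?_ ?_
  · exact (f.smooth n).comp (WithLp.fstL 2 ℝ V V).contDiff
  · exact (g.smooth n).comp (WithLp.sndL 2 ℝ V V).contDiff

theorem tensor_bound (f g : 𝓢(V, ℂ)) (k n : ℕ) (x : WithLp 2 (V × V)) :
    ‖x‖ ^ k * ‖iteratedFDeriv ℝ n (fun z : WithLp 2 (V × V) => f z.fst * g z.snd) x‖ ≤
      2 ^ k * 2 ^ n * 2 * ((Finset.Iic (k, n)).sup (schwartzSeminormFamily ℂ V ℂ) f) *
        ((Finset.Iic (k, n)).sup (schwartzSeminormFamily ℂ V ℂ) g) := by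
  set P := (Finset.Iic (k, n)).sup (schwartzSeminormFamily ℂ V ℂ)
  have hP : ∀ (h : 𝓢(V, ℂ)) (l i : ℕ), l ≤ k → i ≤ n → ∀ y,
      ‖y‖ ^ l * ‖iteratedFDeriv ℝ i h y‖ ≤ P h := by
    intro h l i hl hi y
    refine (h.le_seminorm ℂ l i y).trans ?_
    exact Seminorm.le_def.1 (Finset.le_sup (f := schwartzSeminormFamily ℂ V ℂ)
      (Finset.mem_Iic.2 (Prod.mk_le_mk.2 ⟨hl, hi⟩) : ((l, i) : ℕ × ℕ) ∈ _)) h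
  have hfst : ‖WithLp.fstL 2 ℝ V V‖ ≤ 1 :=
    ContinuousLinearMap.opNorm_le_bound _ zero_le_one fun z => by
      rw [one_mul]; exact WithLp.norm_fst_le V z
  have hsnd : ‖WithLp.sndL 2 ℝ V V‖ ≤ 1 :=
    ContinuousLinearMap.opNorm_le_bound _ zero_le_one fun z => by
      rw [one_mul]; exact WithLp.norm_snd_le V z
  have h1 := norm_iteratedFDeriv_mul_le (𝕜 := ℝ) (N := n)
    (f := fun z : WithLp 2 (V × V) => f z.fst) (g := fun z : WithLp 2 (V × V) => g z.snd)
    ((f.smooth n).comp (WithLp.fstL 2 ℝ V V).contDiff)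
    ((g.smooth n).comp (WithLp.sndL 2 ℝ V V).contDiff) x (n := n) le_rfl
  have h2 : ∀ i ∈ Finset.range (n + 1),
      ‖x‖ ^ k * ((n.choose i : ℝ) *
        ‖iteratedFDeriv ℝ i (fun z : WithLp 2 (V × V) => f z.fst) x‖ *
        ‖iteratedFDeriv ℝ (n - i) (fun z : WithLp 2 (V × V) => g z.snd) x‖) ≤
      (n.choose i : ℝ) * (2 ^ k * 2 * P f * P g) := by
    intro i hi
    have hi' : i ≤ n := Nat.lt_succ_iff.1 (Finset.mem_range.1 hi)
    have a1 := norm_iteratedFDeriv_comp_le f (WithLp.fstL 2 ℝ V V) hfst i x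
    have a2 := norm_iteratedFDeriv_comp_le g (WithLp.sndL 2 ℝ V V) hsnd (n - i) x
    simp only [WithLp.fstL_apply, WithLp.sndL_apply] at a1 a2
    have b1 := hP f k i le_rfl hi' x.fst
    have b2 := hP f 0 i (Nat.zero_le _) hi' x.fst
    have b3 := hP g k (n - i) le_rfl (Nat.sub_le _ _) x.snd
    have b4 := hP g 0 (n - i) (Nat.zero_le _) (Nat.sub_le _ _) x.snd
    rw [pow_zero, one_mul] at b2 b4
    have c := norm_pow_le_prod x k
    have hPf : 0 ≤ P f := apply_nonneg P f
    have hPg : 0 ≤ P g := apply_nonneg P g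
    set A := ‖iteratedFDeriv ℝ i f x.fst‖
    set B := ‖iteratedFDeriv ℝ (n - i) g x.snd‖
    have hA : 0 ≤ A := norm_nonneg _
    have hB : 0 ≤ B := norm_nonneg _
    calc _ ≤ (2 ^ k * (‖x.fst‖ ^ k + ‖x.snd‖ ^ k)) * ((n.choose i : ℝ) * A * B) := by gcongr
      _ = (n.choose i : ℝ) * 2 ^ k * ((‖x.fst‖ ^ k * A) * B + A * (‖x.snd‖ ^ k * B)) := by ring
      _ ≤ (n.choose i : ℝ) * 2 ^ k * (P f * P g + P f * P g) := by gcongr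
      _ = _ := by ring
  calc _ ≤ ‖x‖ ^ k * _ := mul_le_mul_of_nonneg_left h1 (by positivity)
    _ ≤ ∑ i ∈ Finset.range (n + 1), (n.choose i : ℝ) * (2 ^ k * 2 * P f * P g) := by
        rw [Finset.mul_sum]; exact Finset.sum_le_sum h2
    _ = _ := by
        rw [← Finset.sum_mul]
        have := Nat.sum_range_choose n
        have h3 : (∑ i ∈ Finset.range (n + 1), (n.choose i : ℝ)) = 2 ^ n := by exact_mod_cast this
        rw [h3]; ring

/-- The map `f ↦ f ⊗ g` on Schwartz functions. -/
noncomputable def tensorLeft (g : 𝓢(V, ℂ)) : 𝓢(V, ℂ) →L[ℂ] 𝓢(WithLp 2 (V × V), ℂ) :=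
  SchwartzMap.mkCLM (fun f z => f z.fst * g z.snd)
    (fun f f' z => by simp [add_mul]) (fun c f z => by simp [mul_assoc])
    (fun f => contDiff_tensor f g _)
    (fun m => ⟨Finset.Iic (m.1, m.2), 2 ^ m.1 * 2 ^ m.2 * 2 *
        ((Finset.Iic (m.1, m.2)).sup (schwartzSeminormFamily ℂ V ℂ) g), by positivity,
      fun f x => (tensor_bound f g m.1 m.2 x).trans (le_of_eq (by ring))⟩)

/-- The map `g ↦ f ⊗ g` on Schwartz functions. -/
noncomputable def tensorRight (f : 𝓢(V, ℂ)) : 𝓢(V, ℂ) →L[ℂ] 𝓢(WithLp 2 (V × V), ℂ) :=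
  SchwartzMap.mkCLM (fun g z => f z.fst * g z.snd)
    (fun f f' z => by simp [mul_add]) (fun c f z => by simp [mul_left_comm])
    (fun g => contDiff_tensor f g _)
    (fun m => ⟨Finset.Iic (m.1, m.2), 2 ^ m.1 * 2 ^ m.2 * 2 *
        ((Finset.Iic (m.1, m.2)).sup (schwartzSeminormFamily ℂ V ℂ) f), by positivity,
      fun g x => tensor_bound f g m.1 m.2 x⟩)

theorem tensorLeft_apply (f g : 𝓢(V, ℂ)) (z) : tensorLeft g f z = f z.fst * g z.snd := rfl
theorem tensorRight_apply (f g : 𝓢(V, ℂ)) (z) : tensorRight f g z = f z.fst * g z.snd := rfl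
theorem tensorLeft_eq_tensorRight (f g : 𝓢(V, ℂ)) : tensorLeft g f = tensorRight f g := rfl

theorem hasTemperateGrowth_cexp :
    (fun t : ℝ => Complex.exp (t * Complex.I)).HasTemperateGrowth := by
  have hd : ∀ n : ℕ, iteratedDeriv n (fun t : ℝ => Complex.exp (t * Complex.I)) =
      fun t : ℝ => Complex.I ^ n * Complex.exp (t * Complex.I) := by
    intro n
    induction n with
    | zero => simp
    | succ n ih =>
      rw [iteratedDeriv_succ, ih]
      funext t
      have h : HasDerivAt (fun t : ℝ => Complex.exp (t * Complex.I))
          (Complex.exp (t * Complex.I) * (1 * Complex.I)) t :=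
        (((hasDerivAt_id (t : ℂ)).mul_const Complex.I).cexp).comp_ofReal
      rw [(h.const_mul (Complex.I ^ n)).deriv]
      ring
  refine ⟨?_, fun n => ⟨0, 1, fun t => ?_⟩⟩
  · exact ((Complex.ofRealCLM.contDiff).mul contDiff_const).cexp
  · rw [norm_iteratedFDeriv_eq_norm_iteratedDeriv, hd]
    simp [Complex.norm_exp_ofReal_mul_I]

/-- The oscillating factor `(ξ, y) ↦ exp(2πi ⟨ξ, y⟩)`. -/
noncomputable def phase (z : WithLp 2 (V × V)) : ℂ :=
  Complex.exp ((2 * Real.pi * inner ℝ z.fst z.snd : ℝ) * Complex.I)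

theorem phase_hasTemperateGrowth : (phase (V := V)).HasTemperateGrowth := by
  have h : (fun z : WithLp 2 (V × V) =>
      2 * Real.pi * inner ℝ z.fst z.snd).HasTemperateGrowth := by
    refine (Function.HasTemperateGrowth.const _).mul ?_
    exact (innerSL ℝ).bilinear_hasTemperateGrowth (𝕜 := ℝ)
      ((WithLp.fstL 2 ℝ V V).hasTemperateGrowth) ((WithLp.sndL 2 ℝ V V).hasTemperateGrowth)
  exact hasTemperateGrowth_cexp.comp h

theorem graph_antilipschitz (M : V →L[ℝ] V) :
    AntilipschitzWith 1 (fun x : V => WithLp.toLp 2 (x, M x)) :=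
  AntilipschitzWith.of_le_mul_dist fun x y => by
    rw [NNReal.coe_one, one_mul, dist_eq_norm, dist_eq_norm]
    exact WithLp.norm_fst_le V (WithLp.toLp 2 (x, M x) - WithLp.toLp 2 (y, M y))

theorem graph_hasTemperateGrowth (M : V →L[ℝ] V) :
    (fun x : V => WithLp.toLp 2 (x, M x)).HasTemperateGrowth :=
  (((WithLp.prodContinuousLinearEquiv 2 ℝ V V).symm : (V × V) →L[ℝ] WithLp 2 (V × V)).comp
    ((ContinuousLinearMap.id ℝ V).prod M)).hasTemperateGrowth

variable [FiniteDimensional ℝ V] [MeasurableSpace V] [BorelSpace V]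

open FourierTransform

/-- Multiplication by `phase`, followed by the inverse Fourier transform, followed by restriction to the
graph of `M`. Used only to prove that the Moyal product of Schwartz functions is Schwartz and
separately continuous. -/
noncomputable def oscCLM (M : V →L[ℝ] V) : 𝓢(WithLp 2 (V × V), ℂ) →L[ℂ] 𝓢(V, ℂ) :=
  (SchwartzMap.compCLMOfAntilipschitz ℂ (graph_hasTemperateGrowth M) (graph_antilipschitz M)) ∘L
    (fourierInvCLM ℂ 𝓢(WithLp 2 (V × V), ℂ)) ∘L (SchwartzMap.smulLeftCLM ℂ phase)

theorem oscCLM_apply (M : V →L[ℝ] V) (a g : 𝓢(V, ℂ)) (x : V) :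
    oscCLM M (tensorLeft g (𝓕 a)) x =
      ∫ y, a (x + y) * g y * Complex.exp ((2 * Real.pi * inner ℝ y (M x) : ℝ) * Complex.I) := by
  set H := SchwartzMap.smulLeftCLM ℂ phase (tensorLeft g (𝓕 a)) with hH
  have h0 : oscCLM M (tensorLeft g (𝓕 a)) x = 𝓕⁻ (H : WithLp 2 (V × V) → ℂ)
      (WithLp.toLp 2 (x, M x)) := by
    rw [← SchwartzMap.fourierInv_coe]; rfl
  rw [h0, Real.fourierInv_eq']
  set K : WithLp 2 (V × V) → ℂ := fun v =>
    Complex.exp (↑(2 * Real.pi * inner ℝ v (WithLp.toLp 2 (x, M x))) * Complex.I) • H v with hK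
  have hKint : MeasureTheory.Integrable K := by
    refine H.integrable.bdd_mul (c := 1) ?_ ?_
    · refine Continuous.aestronglyMeasurable ?_
      fun_prop
    · exact Filter.Eventually.of_forall fun v => by rw [Complex.norm_exp_ofReal_mul_I]
  have hmp := WithLp.volume_preserving_toLp V V
  have hemb : MeasurableEmbedding (WithLp.toLp 2 : V × V → WithLp 2 (V × V)) :=
    (MeasurableEquiv.toLp 2 (V × V)).measurableEmbedding
  rw [← hmp.integral_comp hemb K]
  have hint : MeasureTheory.Integrable (fun z : V × V => K (WithLp.toLp 2 z)) :=
    (hmp.integrable_comp_emb hemb).2 hKint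
  rw [MeasureTheory.Measure.volume_eq_prod, MeasureTheory.integral_prod_symm _ hint]
  refine MeasureTheory.integral_congr_ae (Filter.Eventually.of_forall fun y => ?_)
  have hinv : a (x + y) = ∫ v, Complex.exp (↑(2 * Real.pi * inner ℝ v (x + y)) * Complex.I) •
      (𝓕 a) v := by
    rw [← Real.fourierInv_eq', ← SchwartzMap.fourierInv_coe, FourierTransform.fourierInv_fourier_eq]
  simp only
  rw [hinv, mul_assoc, ← MeasureTheory.integral_mul_const]
  refine MeasureTheory.integral_congr_ae (Filter.Eventually.of_forall fun v => ?_)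
  simp only [hK, hH]
  rw [SchwartzMap.smulLeftCLM_apply_apply phase_hasTemperateGrowth, tensorLeft_apply, phase]
  simp only [WithLp.prod_inner_apply, smul_eq_mul, inner_add_right]
  push_cast
  simp only [mul_add, add_mul, Complex.exp_add, WithLp.toLp_fst, WithLp.toLp_snd]
  ring

end Auxiliary

open MeasureTheory FourierTransform

/-- The space `ℝ^D`, `D = 2n`. The coordinates are labelled by `(i, k)`: the `i`-th coordinate (`i = 0, 1`)
of the `k`-th block of size two. -/
abbrev Space (n : ℕ) : Type := EuclideanSpace ℝ (Fin 2 × Fin n)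

/-- The block-diagonal matrix `Σ = diag(J, …, J)` with `n` blocks `J = !![0, -1; 1, 0]`. -/
def sigma (n : ℕ) : Matrix (Fin 2 × Fin n) (Fin 2 × Fin n) ℝ :=
  Matrix.blockDiagonal fun _ : Fin n => !![0, -1; 1, 0]

/-- The skew-symmetric matrix `Θ = θ Σ`. -/
noncomputable def Theta (n : ℕ) (θ : ℝ) : Matrix (Fin 2 × Fin n) (Fin 2 × Fin n) ℝ :=
  θ • sigma n

/-- The integral formula of the Moyal product,
`(πθ)^{-D} ∫∫ a(x+y) b(x+z) exp(-2i y Θ⁻¹ z) dz dy` with `D = 2n`. -/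
noncomputable def moyalIntegral (n : ℕ) (θ : ℝ) (a b : Space n → ℂ) (x : Space n) : ℂ :=
  1 / ((Real.pi * θ : ℝ) : ℂ) ^ (2 * n) *
    ∫ y : Space n, ∫ z : Space n, a (x + y) * b (x + z) *
      Complex.exp (-Complex.I * 2 * (y.ofLp ⬝ᵥ ((Theta n θ)⁻¹).mulVec z.ofLp : ℝ))

theorem sigma_mul_neg_sigma (n : ℕ) : sigma n * (-sigma n) = 1 := by
  rw [sigma, ← Matrix.blockDiagonal_neg, ← Matrix.blockDiagonal_mul, ← Matrix.blockDiagonal_one]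
  congr 1
  funext k
  ext i j
  fin_cases i <;> fin_cases j <;> simp

theorem Theta_mul_inv (n : ℕ) (θ : ℝ) [NeZero θ] : Theta n θ * (Theta n θ)⁻¹ = 1 := by
  have h : Theta n θ * (θ⁻¹ • -sigma n) = 1 := by
    rw [Theta, smul_mul_smul_comm, mul_inv_cancel₀ (NeZero.ne θ), sigma_mul_neg_sigma, one_smul]
  rw [Matrix.inv_eq_right_inv h, h]

/-- The linear map with matrix `π⁻¹ Θ⁻¹`. -/
noncomputable def invMap (n : ℕ) (θ : ℝ) : Space n →L[ℝ] Space n :=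
  Real.pi⁻¹ • Matrix.toEuclideanCLM (𝕜 := ℝ) (Theta n θ)⁻¹

theorem inner_invMap (n : ℕ) (θ : ℝ) (y z : Space n) :
    inner ℝ y (invMap n θ z) = Real.pi⁻¹ * (y.ofLp ⬝ᵥ ((Theta n θ)⁻¹).mulVec z.ofLp) := by
  rw [invMap, smul_apply, inner_smul_right,
    EuclideanSpace.inner_eq_star_dotProduct, Matrix.ofLp_toEuclideanCLM, dotProduct_comm]
  simp

theorem norm_le_adjoint_invMap (n : ℕ) (θ : ℝ) [NeZero θ] :
    ∃ (k : ℕ) (C : ℝ), ∀ y : Space n,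
      ‖y‖ ≤ C * (1 + ‖ContinuousLinearMap.adjoint (invMap n θ) y‖) ^ k := by
  set T : Space n →L[ℝ] Space n := Matrix.toEuclideanCLM (𝕜 := ℝ) (Theta n θ) with hT
  have h1 : invMap n θ ∘L (Real.pi • T) = 1 := by
    have : (Theta n θ)⁻¹ * Theta n θ = 1 := mul_eq_one_comm.1 (Theta_mul_inv n θ)
    have h : Matrix.toEuclideanCLM (𝕜 := ℝ) (Theta n θ)⁻¹ * T = 1 := by
      rw [hT, ← map_mul, this, map_one]
    ext1 y
    have hy := DFunLike.congr_fun h y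
    change Real.pi⁻¹ • Matrix.toEuclideanCLM (𝕜 := ℝ) (Theta n θ)⁻¹ (Real.pi • T y) = y
    rw [map_smul, smul_smul, inv_mul_cancel₀ Real.pi_ne_zero, one_smul]
    exact hy
  have h2 : ∀ y, ContinuousLinearMap.adjoint (Real.pi • T)
      (ContinuousLinearMap.adjoint (invMap n θ) y) = y := by
    intro y
    have := congrArg ContinuousLinearMap.adjoint h1
    rw [ContinuousLinearMap.adjoint_comp] at this
    refine (DFunLike.congr_fun this y).trans ?_
    rw [ContinuousLinearMap.one_def, ContinuousLinearMap.adjoint_id]; rfl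
  refine ⟨1, ‖ContinuousLinearMap.adjoint (Real.pi • T)‖, fun y => ?_⟩
  rw [pow_one]
  conv_lhs => rw [← h2 y]
  refine (ContinuousLinearMap.le_opNorm _ _).trans ?_
  gcongr
  linarith

/-- The Fourier transform composed with the adjoint of `invMap`. -/
noncomputable def halfFourier (n : ℕ) (θ : ℝ) [NeZero θ] : 𝓢(Space n, ℂ) →L[ℂ] 𝓢(Space n, ℂ) :=
  SchwartzMap.compCLM ℂ (ContinuousLinearMap.adjoint (invMap n θ)).hasTemperateGrowth
    (norm_le_adjoint_invMap n θ) ∘L fourierCLM ℂ 𝓢(Space n, ℂ)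

/-- The continuous linear map `a ↦ a ⋆ b` on Schwartz functions, see `rightMulCLM_eq`. -/
noncomputable def rightMulCLM (n : ℕ) (θ : ℝ) [NeZero θ] (b : 𝓢(Space n, ℂ)) :
    𝓢(Space n, ℂ) →L[ℂ] 𝓢(Space n, ℂ) :=
  (1 / ((Real.pi * θ : ℝ) : ℂ) ^ (2 * n)) • (oscCLM (invMap n θ) ∘L
    tensorLeft (halfFourier n θ b) ∘L fourierCLM ℂ 𝓢(Space n, ℂ))

/-- The continuous linear map `b ↦ a ⋆ b` on Schwartz functions, see `leftMulCLM_eq`. -/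
noncomputable def leftMulCLM (n : ℕ) (θ : ℝ) [NeZero θ] (a : 𝓢(Space n, ℂ)) :
    𝓢(Space n, ℂ) →L[ℂ] 𝓢(Space n, ℂ) :=
  (1 / ((Real.pi * θ : ℝ) : ℂ) ^ (2 * n)) • (oscCLM (invMap n θ) ∘L
    tensorRight (𝓕 a) ∘L halfFourier n θ)

theorem leftMulCLM_eq_rightMulCLM (n : ℕ) (θ : ℝ) [NeZero θ] (a b : 𝓢(Space n, ℂ)) :
    leftMulCLM n θ a b = rightMulCLM n θ b a := rfl

theorem rightMulCLM_apply (n : ℕ) (θ : ℝ) [NeZero θ] (a b : 𝓢(Space n, ℂ)) (x : Space n) :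
    rightMulCLM n θ b a x = moyalIntegral n θ a b x := by
  change (1 / ((Real.pi * θ : ℝ) : ℂ) ^ (2 * n)) *
    oscCLM (invMap n θ) (tensorLeft (halfFourier n θ b) (𝓕 a)) x = _
  rw [oscCLM_apply, moyalIntegral]
  congr 1
  refine integral_congr_ae (Filter.Eventually.of_forall fun y => ?_)
  simp only [mul_assoc (a (x + y))]
  rw [integral_const_mul]
  congr 1
  have h1 : halfFourier n θ b y =
      𝓕 (b : Space n → ℂ) (ContinuousLinearMap.adjoint (invMap n θ) y) := by
    rw [← SchwartzMap.fourier_coe]; rfl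
  rw [h1, Real.fourier_eq', ← integral_mul_const,
    ← integral_add_left_eq_self (μ := volume) _ x]
  refine integral_congr_ae (Filter.Eventually.of_forall fun z => ?_)
  simp only [smul_eq_mul]
  rw [ContinuousLinearMap.adjoint_inner_right, real_inner_comm, map_add, inner_add_right,
    inner_invMap, inner_invMap, mul_right_comm, ← Complex.exp_add, mul_comm]
  congr 2
  have : (Real.pi : ℂ) ≠ 0 := by exact_mod_cast Real.pi_ne_zero
  push_cast
  field_simp
  ring

/-- The Moyal product `a ⋆ b` of Schwartz functions. -/
noncomputable def moyal (n : ℕ) (θ : ℝ) [NeZero θ] (a b : 𝓢(Space n, ℂ)) : 𝓢(Space n, ℂ) where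
  toFun := moyalIntegral n θ a b
  smooth' := by
    rw [← funext (rightMulCLM_apply n θ a b)]
    exact (rightMulCLM n θ b a).smooth'
  decay' := by
    rw [← funext (rightMulCLM_apply n θ a b)]
    exact (rightMulCLM n θ b a).decay'

theorem rightMulCLM_eq (n : ℕ) (θ : ℝ) [NeZero θ] (a b : 𝓢(Space n, ℂ)) :
    rightMulCLM n θ b a = moyal n θ a b :=
  SchwartzMap.ext (rightMulCLM_apply n θ a b)

theorem leftMulCLM_eq (n : ℕ) (θ : ℝ) [NeZero θ] (a b : 𝓢(Space n, ℂ)) :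
    leftMulCLM n θ a b = moyal n θ a b :=
  SchwartzMap.ext (rightMulCLM_apply n θ a b)

/-- The map `T ↦ T ⋆ a` on tempered distributions, `⟨T ⋆ a, b⟩ = ⟨T, a ⋆ b⟩`. -/
noncomputable def distMul (n : ℕ) (θ : ℝ) [NeZero θ] (a : 𝓢(Space n, ℂ)) :
    𝓢'(Space n, ℂ) →L[ℂ] 𝓢'(Space n, ℂ) :=
  PointwiseConvergenceCLM.precomp ℂ (leftMulCLM n θ a)

theorem distMul_apply (n : ℕ) (θ : ℝ) [NeZero θ] (T : 𝓢'(Space n, ℂ)) (a b : 𝓢(Space n, ℂ)) :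
    distMul n θ a T b = T (moyal n θ a b) :=
  congrArg T (leftMulCLM_eq n θ a b)

/-- The map `T ↦ a ⋆ T` on tempered distributions, `⟨a ⋆ T, b⟩ = ⟨T, b ⋆ a⟩`. -/
noncomputable def mulDist (n : ℕ) (θ : ℝ) [NeZero θ] (a : 𝓢(Space n, ℂ)) :
    𝓢'(Space n, ℂ) →L[ℂ] 𝓢'(Space n, ℂ) :=
  PointwiseConvergenceCLM.precomp ℂ (rightMulCLM n θ a)

theorem mulDist_apply (n : ℕ) (θ : ℝ) [NeZero θ] (T : 𝓢'(Space n, ℂ)) (a b : 𝓢(Space n, ℂ)) :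
    mulDist n θ a T b = T (moyal n θ b a) :=
  congrArg T (rightMulCLM_eq n θ b a)

/-- The inclusion of `𝓢` into `𝓢'`, `⟨c, b⟩ = ∫ b(x) c(x) dx`. -/
noncomputable def schwartzToDist (n : ℕ) : 𝓢(Space n, ℂ) →L[ℂ] 𝓢'(Space n, ℂ) :=
  SchwartzMap.toTemperedDistributionCLM (Space n) ℂ volume

theorem schwartzToDist_injective (n : ℕ) : Function.Injective (schwartzToDist n) := by
  refine (injective_iff_map_eq_zero _).2 fun f hf => ?_
  have h := (LinearMap.ker_eq_bot'.1
    (Lp.ker_toTemperedDistributionCLM_eq_bot (F := ℂ) (μ := (volume : Measure (Space n)))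
      (p := 2))) (f.toLp 2) (by
      rw [ContinuousLinearMap.coe_coe, Lp.toTemperedDistributionCLM_apply,
        Lp.toTemperedDistribution_toLp_eq]
      exact hf)
  exact SchwartzMap.injective_toLp 2 volume (h.trans (map_zero (SchwartzMap.toLpCLM ℂ ℂ 2 volume)).symm)

/-- The space `𝓢` as a subspace of `𝓢'`. -/
noncomputable def schwartzDist (n : ℕ) : Submodule ℂ 𝓢'(Space n, ℂ) :=
  LinearMap.range (schwartzToDist n).toLinearMap

/-- `{T | a ⋆ T ∈ 𝓢 for all a ∈ 𝓢}`. -/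
noncomputable def leftMoyalAlgebra (n : ℕ) (θ : ℝ) [NeZero θ] : Submodule ℂ 𝓢'(Space n, ℂ) :=
  ⨅ a : 𝓢(Space n, ℂ), (schwartzDist n).comap (mulDist n θ a).toLinearMap

/-- `{T | T ⋆ a ∈ 𝓢 for all a ∈ 𝓢}`. -/
noncomputable def rightMoyalAlgebra (n : ℕ) (θ : ℝ) [NeZero θ] : Submodule ℂ 𝓢'(Space n, ℂ) :=
  ⨅ a : 𝓢(Space n, ℂ), (schwartzDist n).comap (distMul n θ a).toLinearMap

/-- The Moyal algebra. -/
noncomputable def moyalAlgebra (n : ℕ) (θ : ℝ) [NeZero θ] : Submodule ℂ 𝓢'(Space n, ℂ) :=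
  leftMoyalAlgebra n θ ⊓ rightMoyalAlgebra n θ

theorem mem_moyalAlgebra (n : ℕ) (θ : ℝ) [NeZero θ] (T : 𝓢'(Space n, ℂ)) :
    T ∈ moyalAlgebra n θ ↔
      (∀ a, ∃ c, schwartzToDist n c = mulDist n θ a T) ∧
      (∀ a, ∃ c, schwartzToDist n c = distMul n θ a T) := by
  simp only [moyalAlgebra, leftMoyalAlgebra, rightMoyalAlgebra, Submodule.mem_inf,
    Submodule.mem_iInf, Submodule.mem_comap, schwartzDist, LinearMap.mem_range]
  rfl

/-- For `T` in the Moyal algebra, the linear map `a ↦ T ⋆ a` from `𝓢` to `𝓢`: the tempered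
distribution `T ⋆ a` is identified with the unique Schwartz function that represents it. -/
noncomputable def leftAction (n : ℕ) (θ : ℝ) [NeZero θ] (T : moyalAlgebra n θ) :
    𝓢(Space n, ℂ) →ₗ[ℂ] 𝓢(Space n, ℂ) where
  toFun a := (((mem_moyalAlgebra n θ T).1 T.2).2 a).choose
  map_add' a b := by
    apply schwartzToDist_injective n
    rw [map_add, (((mem_moyalAlgebra n θ T).1 T.2).2 _).choose_spec,
      (((mem_moyalAlgebra n θ T).1 T.2).2 _).choose_spec,
      (((mem_moyalAlgebra n θ T).1 T.2).2 _).choose_spec]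
    refine DFunLike.ext _ _ fun c => ?_
    change T.1 (rightMulCLM n θ c (a + b)) = T.1 (rightMulCLM n θ c a) + T.1 (rightMulCLM n θ c b)
    rw [map_add, map_add]
  map_smul' r a := by
    apply schwartzToDist_injective n
    rw [map_smul, (((mem_moyalAlgebra n θ T).1 T.2).2 _).choose_spec,
      (((mem_moyalAlgebra n θ T).1 T.2).2 _).choose_spec]
    refine DFunLike.ext _ _ fun c => ?_
    change T.1 (rightMulCLM n θ c (r • a)) = r • T.1 (rightMulCLM n θ c a)
    rw [map_smul, map_smul]

theorem schwartzToDist_leftAction (n : ℕ) (θ : ℝ) [NeZero θ] (T : moyalAlgebra n θ)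
    (a : 𝓢(Space n, ℂ)) : schwartzToDist n (leftAction n θ T a) = distMul n θ a T :=
  (((mem_moyalAlgebra n θ T).1 T.2).2 a).choose_spec

/-- The Moyal product `S ⋆ T` of two elements of the Moyal algebra, as a linear functional on `𝓢`:
`⟨S ⋆ T, a⟩ = ⟨S, T ⋆ a⟩`, where `T ⋆ a` is a Schwartz function because `T` is a multiplier. -/
noncomputable def moyalMul (n : ℕ) (θ : ℝ) [NeZero θ] (S T : moyalAlgebra n θ) :
    𝓢(Space n, ℂ) →ₗ[ℂ] ℂ :=
  S.1.toLinearMap ∘ₗ leftAction n θ T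

/-- The Moyal bracket `[S, T]_⋆ = S ⋆ T - T ⋆ S`. -/
noncomputable def moyalBracket (n : ℕ) (θ : ℝ) [NeZero θ] (S T : moyalAlgebra n θ) :
    𝓢(Space n, ℂ) →ₗ[ℂ] ℂ :=
  moyalMul n θ S T - moyalMul n θ T S

/-- The polynomial function on `ℝ^{2n}` defined by a polynomial with complex coefficients. -/
noncomputable def polyFun (n : ℕ) (p : MvPolynomial (Fin 2 × Fin n) ℂ) (x : Space n) : ℂ :=
  MvPolynomial.eval (fun μ => (x.ofLp μ : ℂ)) p

theorem polyFun_hasTemperateGrowth (n : ℕ) (p : MvPolynomial (Fin 2 × Fin n) ℂ) :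
    (polyFun n p).HasTemperateGrowth := by
  induction p using MvPolynomial.induction_on with
  | C c =>
    have : polyFun n (MvPolynomial.C c) = fun _ => c := by funext x; simp [polyFun]
    rw [this]; exact Function.HasTemperateGrowth.const c
  | add p q hp hq =>
    have : polyFun n (p + q) = polyFun n p + polyFun n q := by funext x; simp [polyFun]
    rw [this]; exact hp.add hq
  | mul_X p μ hp =>
    have : polyFun n (p * MvPolynomial.X μ) = polyFun n p *
        (Complex.ofRealCLM ∘L (EuclideanSpace.proj μ : Space n →L[ℝ] ℝ) : Space n →L[ℝ] ℂ) := by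
      funext x; simp [polyFun]
    rw [this]; exact hp.mul (ContinuousLinearMap.hasTemperateGrowth _)

/-- A polynomial function as a tempered distribution, `⟨p, a⟩ = ∫ a(x) p(x) dx`. -/
noncomputable def polyDist (n : ℕ) :
    MvPolynomial (Fin 2 × Fin n) ℂ →ₗ[ℂ] 𝓢'(Space n, ℂ) where
  toFun p := (polyFun_hasTemperateGrowth n p).toTemperedDistribution volume
  map_add' p q := by
    refine DFunLike.ext _ _ fun a => ?_
    have hi : ∀ p, Integrable fun x => a x • polyFun n p x := fun p =>
      (SchwartzMap.bilinLeftCLM (ContinuousLinearMap.lsmul ℂ ℂ)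
        (polyFun_hasTemperateGrowth n p) a).integrable
    change ∫ x, a x • polyFun n (p + q) x =
      (∫ x, a x • polyFun n p x) + ∫ x, a x • polyFun n q x
    rw [← integral_add (hi p) (hi q)]
    simp [polyFun, mul_add]
  map_smul' c p := by
    refine DFunLike.ext _ _ fun a => ?_
    change ∫ x, a x • polyFun n (c • p) x = c • ∫ x, a x • polyFun n p x
    rw [← integral_smul]
    simp [polyFun, mul_left_comm]

theorem polyDist_apply (n : ℕ) (p : MvPolynomial (Fin 2 × Fin n) ℂ) (a : 𝓢(Space n, ℂ)) :
    polyDist n p a = ∫ x, a x * polyFun n p x := rfl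

/-- The space `𝒫₂` of polynomial functions of degree at most `2`. -/
noncomputable def polyTwo (n : ℕ) : Submodule ℂ 𝓢'(Space n, ℂ) :=
  (MvPolynomial.restrictTotalDegree (Fin 2 × Fin n) ℂ 2).map (polyDist n)

/-- The Poisson bracket `{p, q} = ∑ Θ_{μν} ∂_μ p ∂_ν q`. -/
noncomputable def poissonBracket (n : ℕ) (θ : ℝ) (p q : MvPolynomial (Fin 2 × Fin n) ℂ) :
    MvPolynomial (Fin 2 × Fin n) ℂ :=
  ∑ μ, ∑ ν, (Theta n θ μ ν : ℂ) • (MvPolynomial.pderiv μ p * MvPolynomial.pderiv ν q)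

/-- A bilinear map `L × L → L` is a Lie bracket if it is alternating and satisfies the Jacobi
identity. -/
def IsLieBracket {L : Type*} [AddCommGroup L] [Module ℂ L] (B : L →ₗ[ℂ] L →ₗ[ℂ] L) : Prop :=
  (∀ x, B x x = 0) ∧ ∀ x y z, B x (B y z) + B y (B z x) + B z (B x y) = 0

end Moyal

/-! Left Moyal multiplication by `x_μ` is the differential operator `L_μ = x_μ + (i/2) ∑_ν Θ_{μν}
∂_ν`. Two facts make this usable. It commutes with right multiplication, `L_μ (a ⋆ b) = (L_μ a) ⋆ b`
(`starCoord_moyal`), and the product is tracial, `∫ a ⋆ b = ∫ a b` (`integral_moyal`). So if an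
operator `A` commutes with right multiplications and `T a = ∫ A a`, then `⟨T, a ⋆ b⟩ = ∫ (A a) b`,
that is, `T ⋆ a = A a` is Schwartz. `Represents` records this situation. The other side is free,
since exchanging the factors amounts to replacing `θ` by `-θ` (`moyal_neg`).

Let `ℓ` be affine, `L` its operator and `M` pointwise multiplication by `ℓ`. Then `∫ L a = ∫ M a`,
because derivatives integrate to zero, and `L M = M L`, because `Θ` is antisymmetric. Hence `∫ L² a
= ∫ ℓ² a`, and `ℓ²` is represented by `L²`. Squares of affine functions span the polynomials of
degree at most two by polarization, so every element of `𝒫₂` is represented.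

The Heisenberg relations give `[F, G] = k` with `k` a scalar for the operators of two affine
functions `f`, `g`. Then `[F², G²] = 2k (FG + GF)`, which is the operator of `4k f g = i {f², g²}`.
By bilinearity the operator commutator matches `i {·,·}` on all of `𝒫₂`
(`poissonBracket_mem_quadPairs`). The Lie identities are inherited from the associative algebra of
operators. -/

open MeasureTheory FourierTransform

namespace Moyal

/-! ### Derivative and total integral of the oscillatory integral behind the product. -/

section OscillatoryIntegral

open scoped LineDeriv

variable {V : Type*} [NormedAddCommGroup V] [InnerProductSpace ℝ V] [FiniteDimensional ℝ V]
  [MeasurableSpace V] [BorelSpace V]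

/-- The oscillatory integral `x ↦ ∫ a(x + y) g(y) exp(2πi ⟨y, M x⟩) dy`. -/
noncomputable def oscInt (M : V →L[ℝ] V) (a g : 𝓢(V, ℂ)) (x : V) : ℂ :=
  ∫ y, a (x + y) * g y * Complex.exp ((2 * Real.pi * inner ℝ y (M x) : ℝ) * Complex.I)

theorem integrable_oscInt (M : V →L[ℝ] V) (a g : 𝓢(V, ℂ)) (x : V) :
    Integrable fun y =>
      a (x + y) * g y * Complex.exp ((2 * Real.pi * inner ℝ y (M x) : ℝ) * Complex.I) := by
  have h : Integrable fun y => a (x + y) * g y := by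
    refine g.integrable.bdd_mul (c := SchwartzMap.seminorm ℂ 0 0 a) ?_ ?_
    · exact (a.continuous.comp (continuous_const.add continuous_id)).aestronglyMeasurable
    · exact Filter.Eventually.of_forall fun y => a.norm_le_seminorm ℂ (x + y)
  refine h.mul_bdd (c := 1) ?_ ?_
  · refine Continuous.aestronglyMeasurable ?_
    fun_prop
  · exact Filter.Eventually.of_forall fun v => by rw [Complex.norm_exp_ofReal_mul_I]

/-- Differentiation under the integral: the derivative falls on `a` and on the phase. The latter
brings down `2πi ⟨y, M m⟩`, and this linear factor is absorbed into `g` through the Schwartz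
function `h`. Domination uses the suprema of `a` and `∂_m a` against the integrable `g` and `h`. -/
theorem hasLineDerivAt_oscInt (M : V →L[ℝ] V) (a g h : 𝓢(V, ℂ)) (m x : V)
    (hh : ∀ y, h y = inner ℝ y (M m) * g y) :
    HasLineDerivAt ℝ (oscInt M a g)
      (oscInt M (∂_{m} a) g x + 2 * Real.pi * Complex.I * oscInt M a h x) x m := by
  set φ : ℝ → V → ℂ := fun t y =>
    Complex.exp ((2 * Real.pi * inner ℝ y (M (x + t • m)) : ℝ) * Complex.I) with hφ
  have hφn : ∀ t y, ‖φ t y‖ = 1 := fun t y => Complex.norm_exp_ofReal_mul_I _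
  set F : ℝ → V → ℂ := fun t y => a (x + t • m + y) * g y * φ t y with hF
  set F' : ℝ → V → ℂ := fun t y => (∂_{m} a : 𝓢(V, ℂ)) (x + t • m + y) * g y * φ t y +
      2 * Real.pi * Complex.I * (a (x + t • m + y) * h y * φ t y) with hF'
  have hFint : ∀ t, Integrable (F t) := fun t => integrable_oscInt M a g (x + t • m)
  have hF1 : ∀ t, Integrable fun y => (∂_{m} a : 𝓢(V, ℂ)) (x + t • m + y) * g y * φ t y :=
    fun t => integrable_oscInt M (∂_{m} a) g (x + t • m)
  have hF2 : ∀ t, Integrable fun y => 2 * Real.pi * Complex.I *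
      (a (x + t • m + y) * h y * φ t y) :=
    fun t => (integrable_oscInt M a h (x + t • m)).const_mul _
  have hbound : ∀ y t, ‖F' t y‖ ≤ SchwartzMap.seminorm ℂ 0 0 (∂_{m} a : 𝓢(V, ℂ)) * ‖g y‖ +
      2 * Real.pi * (SchwartzMap.seminorm ℂ 0 0 a * ‖h y‖) := by
    intro y t
    refine (norm_add_le _ _).trans ?_
    simp only [norm_mul, hφn, Complex.norm_I, mul_one,
      Complex.norm_real, Complex.norm_ofNat, Real.norm_of_nonneg Real.pi_pos.le]
    gcongr
    · exact SchwartzMap.norm_le_seminorm ℂ (∂_{m} a : 𝓢(V, ℂ)) _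
    · exact SchwartzMap.norm_le_seminorm ℂ a _
  have hderiv : ∀ y t, HasDerivAt (fun t => F t y) (F' t y) t := by
    intro y t
    have e1 : HasDerivAt (fun t : ℝ => a (x + t • m + y))
        ((∂_{m} a : 𝓢(V, ℂ)) (x + t • m + y)) t := by
      have h1 : HasDerivAt (fun t : ℝ => x + t • m + y) m t := by
        simpa using (((hasDerivAt_id t).smul_const m).const_add x).add_const y
      exact (a.hasFDerivAt (x + t • m + y)).comp_hasDerivAt t h1
    have e2 : HasDerivAt (fun t : ℝ =>
        (((2 * Real.pi * inner ℝ y (M (x + t • m)) : ℝ) : ℂ) * Complex.I))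
        (((2 * Real.pi * inner ℝ y (M m) : ℝ) : ℂ) * Complex.I) t := by
      have h1 : HasDerivAt (fun t : ℝ => 2 * Real.pi * inner ℝ y (M (x + t • m)))
          (2 * Real.pi * inner ℝ y (M m)) t := by
        simp only [map_add, map_smul, inner_add_right, inner_smul_right]
        simpa using (((hasDerivAt_id t).mul_const (inner ℝ y (M m))).const_add
          (inner ℝ y (M x))).const_mul (2 * Real.pi)
      exact h1.ofReal_comp.mul_const Complex.I
    refine ((e1.mul_const (g y)).mul e2.cexp).congr_deriv ?_
    simp only [hF', hφ, hh]
    push_cast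
    ring
  have key := (hasDerivAt_integral_of_dominated_loc_of_deriv_le (μ := (volume : Measure V))
    (F := F) (F' := F') (x₀ := 0) (s := Set.univ)
    Filter.univ_mem (Filter.Eventually.of_forall fun t => (hFint t).aestronglyMeasurable)
    (hFint 0) ((hF1 0).add (hF2 0)).aestronglyMeasurable
    (Filter.Eventually.of_forall fun y t _ => hbound y t)
    ((g.integrable.norm.const_mul _).add ((h.integrable.norm.const_mul _).const_mul _))
    (Filter.Eventually.of_forall fun y t _ => hderiv y t)).2
  simp only [hF'] at key
  rw [integral_add (hF1 0) (hF2 0), integral_const_mul] at key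
  simpa [HasLineDerivAt, oscInt, hF, hφ] using key

/-- After Fubini, the shift `x ↦ x - y` turns `a (x + y)` into `a x` and leaves the phase alone
because `⟨y, M y⟩ = 0`. The remaining integral over `y` is an inverse Fourier transform. -/
theorem integral_oscInt (M : V →L[ℝ] V) (hM : ∀ y, inner ℝ y (M y) = 0) (a g : 𝓢(V, ℂ)) :
    ∫ x, oscInt M a g x = ∫ x, a x * 𝓕⁻ (g : V → ℂ) (M x) := by
  have hint : Integrable (fun p : V × V => a (p.1 + p.2) * g p.2 *
      Complex.exp ((2 * Real.pi * inner ℝ p.2 (M p.1) : ℝ) * Complex.I))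
      (volume.prod volume) := by
    refine Integrable.mul_bdd (c := 1) ?_ ?_ ?_
    -- The integrand `a (x + y) g y` is a convolution integrand once the sign of `y` is reversed.
    · have hg : Integrable (fun y => g (-y)) (volume : Measure V) := g.integrable.comp_neg
      have h := (hg.convolution_integrand (ContinuousLinearMap.mul ℝ ℂ).flip (μ := (volume : Measure V))
        a.integrable)
      have hmp : MeasurePreserving (fun p : V × V => (p.1, -p.2)) (volume.prod volume)
          (volume.prod volume) :=
        (MeasurePreserving.id volume).prod (Measure.measurePreserving_neg volume)
      simpa [Function.comp_def, mul_comm] using hmp.integrable_comp_of_integrable h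
    · refine Continuous.aestronglyMeasurable ?_
      fun_prop
    · exact Filter.Eventually.of_forall fun v => by rw [Complex.norm_exp_ofReal_mul_I]
  have hint2 : Integrable (fun p : V × V => a p.1 * g p.2 *
      Complex.exp ((2 * Real.pi * inner ℝ p.2 (M p.1) : ℝ) * Complex.I))
      (volume.prod volume) := by
    refine (a.integrable.mul_prod g.integrable).mul_bdd (c := 1) ?_ ?_
    · refine Continuous.aestronglyMeasurable ?_
      fun_prop
    · exact Filter.Eventually.of_forall fun v => by rw [Complex.norm_exp_ofReal_mul_I]
  unfold oscInt
  rw [integral_integral_swap hint]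
  have h1 : ∀ y : V, ∫ x, a (x + y) * g y *
      Complex.exp ((2 * Real.pi * inner ℝ y (M x) : ℝ) * Complex.I) =
      ∫ x, a x * g y * Complex.exp ((2 * Real.pi * inner ℝ y (M x) : ℝ) * Complex.I) := by
    intro y
    rw [← integral_add_right_eq_self (μ := volume) (fun x => a x * g y *
      Complex.exp ((2 * Real.pi * inner ℝ y (M x) : ℝ) * Complex.I)) y]
    simp only [map_add, inner_add_right, hM, add_zero]
  simp_rw [h1]
  rw [← integral_integral_swap hint2]
  refine integral_congr_ae (Filter.Eventually.of_forall fun x => ?_)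
  simp only
  rw [Real.fourierInv_eq', ← integral_const_mul]
  refine integral_congr_ae (Filter.Eventually.of_forall fun y => ?_)
  simp only [smul_eq_mul]
  ring

theorem integral_comp_continuousLinearMap (T : V →L[ℝ] V) (hT : T.det ≠ 0) (f : V → ℂ) :
    ∫ x, f (T x) = (|T.det|⁻¹ : ℝ) * ∫ x, f x := by
  have hT' : LinearMap.det (T : V →ₗ[ℝ] V) ≠ 0 := hT
  have hemb : MeasurableEmbedding T :=
    (T.toContinuousLinearEquivOfDetNeZero hT).toHomeomorph.measurableEmbedding
  rw [← hemb.integral_map]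
  have := Measure.map_linearMap_addHaar_eq_smul_addHaar (volume : Measure V) hT'
  rw [ContinuousLinearMap.coe_coe] at this
  rw [this, integral_smul_measure, ENNReal.toReal_ofReal (abs_nonneg _), abs_inv]
  rfl

end OscillatoryIntegral

/-! ### Linear algebra of `Θ`: antisymmetry, inverse, determinant. -/

section Theta

theorem sigma_transpose (n : ℕ) : (sigma n).transpose = -sigma n := by
  rw [sigma, Matrix.blockDiagonal_transpose, ← Matrix.blockDiagonal_neg]
  congr 1
  funext k
  ext i j
  fin_cases i <;> fin_cases j <;> simp

theorem Theta_transpose (n : ℕ) (θ : ℝ) : (Theta n θ).transpose = -Theta n θ := by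
  rw [Theta, Matrix.transpose_smul, sigma_transpose, smul_neg]

theorem Theta_swap (n : ℕ) (θ : ℝ) (μ ν : Fin 2 × Fin n) : Theta n θ ν μ = -Theta n θ μ ν :=
  congrFun (congrFun (Theta_transpose n θ) μ) ν

theorem Theta_neg (n : ℕ) (θ : ℝ) : Theta n (-θ) = -Theta n θ := by
  rw [Theta, Theta, neg_smul]

theorem Theta_inv_neg (n : ℕ) (θ : ℝ) [NeZero θ] : (Theta n (-θ))⁻¹ = -(Theta n θ)⁻¹ :=
  Matrix.inv_eq_right_inv (by rw [Theta_neg, neg_mul_neg, Theta_mul_inv])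

theorem Theta_inv_transpose (n : ℕ) (θ : ℝ) [NeZero θ] :
    ((Theta n θ)⁻¹).transpose = -(Theta n θ)⁻¹ := by
  rw [Matrix.transpose_nonsing_inv, Theta_transpose, ← Theta_neg, Theta_inv_neg]

theorem det_Theta (n : ℕ) (θ : ℝ) : (Theta n θ).det = θ ^ (2 * n) := by
  rw [Theta, Matrix.det_smul, sigma, Matrix.det_blockDiagonal]
  simp [Matrix.det_fin_two]

theorem inner_invMap_self (n : ℕ) (θ : ℝ) [NeZero θ] (y : Space n) :
    inner ℝ y (invMap n θ y) = 0 := by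
  have h : y.ofLp ⬝ᵥ (((Theta n θ)⁻¹).transpose).mulVec y.ofLp =
      y.ofLp ⬝ᵥ ((Theta n θ)⁻¹).mulVec y.ofLp := by
    rw [Matrix.mulVec_transpose, dotProduct_comm, Matrix.dotProduct_mulVec]
  rw [Theta_inv_transpose, Matrix.neg_mulVec, dotProduct_neg] at h
  rw [inner_invMap]
  have : y.ofLp ⬝ᵥ ((Theta n θ)⁻¹).mulVec y.ofLp = 0 := by linarith
  rw [this, mul_zero]

/-- The row of `Θ` with index `μ`. -/
noncomputable def rowVec (n : ℕ) (θ : ℝ) (μ : Fin 2 × Fin n) : Space n :=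
  WithLp.toLp 2 (Theta n θ μ)

/-- Differentiating the phase along row `μ` of `Θ` therefore multiplies by a multiple of the single
coordinate `y_μ`. -/
theorem inner_invMap_rowVec (n : ℕ) (θ : ℝ) [NeZero θ] (y : Space n) (μ : Fin 2 × Fin n) :
    inner ℝ y (invMap n θ (rowVec n θ μ)) = -(Real.pi⁻¹ * y.ofLp μ) := by
  have h : ((Theta n θ)⁻¹).mulVec (Theta n θ μ) = -Pi.single μ 1 := by
    have h1 : (Theta n θ)⁻¹ * (Theta n θ).transpose = -1 := by
      rw [Theta_transpose, mul_neg, mul_eq_one_comm.1 (Theta_mul_inv n θ)]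
    funext ν
    refine (congrFun (congrFun h1 ν) μ).trans ?_
    simp [Matrix.one_apply, Pi.single_apply]
  rw [inner_invMap, rowVec]
  simp [h]

/-- The Jacobian that cancels the prefactor `(πθ)^{-2n}` in `integral_moyal`. No absolute value is
needed on the right, as the exponent is even. -/
theorem abs_det_adjoint_invMap (n : ℕ) (θ : ℝ) [NeZero θ] :
    |(ContinuousLinearMap.adjoint (invMap n θ)).det| = ((Real.pi * θ) ^ (2 * n))⁻¹ := by
  have h : ContinuousLinearMap.adjoint (invMap n θ) =
      Matrix.toEuclideanCLM (𝕜 := ℝ) (Real.pi⁻¹ • star (Theta n θ)⁻¹) := by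
    rw [map_smul, map_star, ContinuousLinearMap.star_eq_adjoint, invMap, map_smulₛₗ]
    simp
  have hd : ∀ A : Matrix (Fin 2 × Fin n) (Fin 2 × Fin n) ℝ,
      (Matrix.toEuclideanCLM (𝕜 := ℝ) A).det = A.det := fun A => by
    rw [ContinuousLinearMap.det, Matrix.coe_toEuclideanCLM_eq_toEuclideanLin,
      Matrix.toEuclideanLin_eq_toLin_orthonormal, LinearMap.det_toLin]
  rw [h, hd, Matrix.det_smul, Matrix.star_eq_conjTranspose, Matrix.det_conjTranspose,
    Matrix.det_nonsing_inv, det_Theta, Ring.inverse_eq_inv']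
  have h0 : 0 ≤ (Real.pi * θ) ^ (2 * n) := by rw [pow_mul]; positivity
  rw [← abs_of_nonneg (inv_nonneg.2 h0)]
  simp [mul_pow, mul_comm]

end Theta

/-! ### The operators of the coordinates, the trace property and the exchange of factors. -/

section Operators

theorem hasTemperateGrowth_coord (n : ℕ) (μ : Fin 2 × Fin n) :
    (fun x : Space n => (x.ofLp μ : ℂ)).HasTemperateGrowth :=
  (Complex.ofRealCLM ∘L (EuclideanSpace.proj μ : Space n →L[ℝ] ℝ) :
    Space n →L[ℝ] ℂ).hasTemperateGrowth

/-- Multiplication by the coordinate `x_μ`. -/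
noncomputable def coordMul (n : ℕ) (μ : Fin 2 × Fin n) : 𝓢(Space n, ℂ) →L[ℂ] 𝓢(Space n, ℂ) :=
  SchwartzMap.smulLeftCLM ℂ fun x : Space n => (x.ofLp μ : ℂ)

theorem coordMul_apply (n : ℕ) (μ : Fin 2 × Fin n) (a : 𝓢(Space n, ℂ)) (x : Space n) :
    coordMul n μ a x = x.ofLp μ * a x :=
  SchwartzMap.smulLeftCLM_apply_apply (hasTemperateGrowth_coord n μ) a x

/-- The derivative `∑_ν Θ_{μν} ∂_ν`. -/
noncomputable def thetaDeriv (n : ℕ) (θ : ℝ) (μ : Fin 2 × Fin n) :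
    𝓢(Space n, ℂ) →L[ℂ] 𝓢(Space n, ℂ) :=
  LineDeriv.lineDerivOpCLM ℂ 𝓢(Space n, ℂ) (rowVec n θ μ)

/-- The operator `a ↦ x_μ ⋆ a = x_μ a + (i/2) ∑_ν Θ_{μν} ∂_ν a`. -/
noncomputable def starCoord (n : ℕ) (θ : ℝ) (μ : Fin 2 × Fin n) :
    𝓢(Space n, ℂ) →L[ℂ] 𝓢(Space n, ℂ) :=
  coordMul n μ + (Complex.I / 2) • thetaDeriv n θ μ

theorem moyal_eq_oscInt (n : ℕ) (θ : ℝ) [NeZero θ] (a b : 𝓢(Space n, ℂ)) (x : Space n) :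
    moyal n θ a b x = 1 / ((Real.pi * θ : ℝ) : ℂ) ^ (2 * n) *
      oscInt (invMap n θ) a (halfFourier n θ b) x := by
  rw [← rightMulCLM_eq, oscInt, ← oscCLM_apply]
  rfl

theorem thetaDeriv_moyal (n : ℕ) (θ : ℝ) [NeZero θ] (μ : Fin 2 × Fin n) (a b : 𝓢(Space n, ℂ))
    (x : Space n) :
    thetaDeriv n θ μ (moyal n θ a b) x = 1 / ((Real.pi * θ : ℝ) : ℂ) ^ (2 * n) *
      (oscInt (invMap n θ) (thetaDeriv n θ μ a) (halfFourier n θ b) x -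
        2 * Complex.I * oscInt (invMap n θ) a (coordMul n μ (halfFourier n θ b)) x) := by
  have h1 := (hasLineDerivAt_oscInt (invMap n θ) a (halfFourier n θ b)
    -- The scalar `-π⁻¹` comes from `inner_invMap_rowVec`; times `2πi` it yields the `-2i` of the
    -- statement.
    (-(Real.pi⁻¹ : ℂ) • coordMul n μ (halfFourier n θ b)) (rowVec n θ μ) x (fun y => by
      rw [inner_invMap_rowVec]
      simp [coordMul_apply, mul_assoc])).const_mul (1 / ((Real.pi * θ : ℝ) : ℂ) ^ (2 * n))
  simp only [← moyal_eq_oscInt] at h1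
  have h2 : thetaDeriv n θ μ (moyal n θ a b) x =
      lineDeriv ℝ (moyal n θ a b) x (rowVec n θ μ) :=
    SchwartzMap.lineDerivOp_apply _ _ _
  rw [h2, HasLineDerivAt.lineDeriv (f := moyal n θ a b) h1]
  congr 1
  have h3 : oscInt (invMap n θ) a (-(Real.pi⁻¹ : ℂ) • coordMul n μ (halfFourier n θ b)) x =
      -(Real.pi⁻¹ : ℂ) * oscInt (invMap n θ) a (coordMul n μ (halfFourier n θ b)) x := by
    rw [oscInt, oscInt, ← integral_const_mul]
    refine integral_congr_ae (Filter.Eventually.of_forall fun y => ?_)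
    simp only [smul_apply, smul_eq_mul]
    ring
  rw [h3]
  have : (Real.pi : ℂ) ≠ 0 := by exact_mod_cast Real.pi_ne_zero
  change oscInt (invMap n θ) (thetaDeriv n θ μ a) (halfFourier n θ b) x + _ = _
  field_simp
  ring

/-- Write `x_μ = (x + y)_μ - y_μ` under the integral. -/
theorem coord_mul_oscInt (n : ℕ) (M : Space n →L[ℝ] Space n) (μ : Fin 2 × Fin n)
    (a g : 𝓢(Space n, ℂ)) (x : Space n) :
    x.ofLp μ * oscInt M a g x = oscInt M (coordMul n μ a) g x - oscInt M a (coordMul n μ g) x := by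
  rw [oscInt, oscInt, oscInt, ← integral_const_mul,
    ← integral_sub (integrable_oscInt _ _ _ _) (integrable_oscInt _ _ _ _)]
  refine integral_congr_ae (Filter.Eventually.of_forall fun y => ?_)
  simp only [coordMul_apply, WithLp.ofLp_add, Pi.add_apply, Complex.ofReal_add]
  ring

/-- This is `x_μ ⋆ (a ⋆ b) = (x_μ ⋆ a) ⋆ b`. Multiplication by `x_μ` leaves an error `-y_μ` under
the integral, and the derivative leaves `(i/2)(-2i) y_μ = y_μ`; the two cancel. -/
theorem starCoord_moyal (n : ℕ) (θ : ℝ) [NeZero θ] (μ : Fin 2 × Fin n) (a b : 𝓢(Space n, ℂ)) :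
    starCoord n θ μ (moyal n θ a b) = moyal n θ (starCoord n θ μ a) b := by
  ext x
  have h1 : starCoord n θ μ (moyal n θ a b) x = x.ofLp μ * moyal n θ a b x +
      Complex.I / 2 * thetaDeriv n θ μ (moyal n θ a b) x := by
    rw [← coordMul_apply]; rfl
  have h2 : moyal n θ (starCoord n θ μ a) b = moyal n θ (coordMul n μ a) b +
      (Complex.I / 2) • moyal n θ (thetaDeriv n θ μ a) b := by
    simp only [← rightMulCLM_eq, ← map_smul (rightMulCLM n θ b), ← map_add]; rfl
  rw [h1, h2, add_apply, smul_apply, thetaDeriv_moyal, moyal_eq_oscInt,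
    moyal_eq_oscInt, moyal_eq_oscInt, mul_left_comm, coord_mul_oscInt, smul_eq_mul]
  linear_combination -(1 / ((Real.pi * θ : ℝ) : ℂ) ^ (2 * n)) *
    oscInt (invMap n θ) a (coordMul n μ (halfFourier n θ b)) x * Complex.I_sq

/-- By `integral_oscInt`, `b` enters through the inverse Fourier transform of its rescaled Fourier
transform. The substitution `u = M' y` and Fourier inversion give back `b`, and the Jacobian cancels
the prefactor. -/
theorem integral_moyal (n : ℕ) (θ : ℝ) [NeZero θ] (a b : 𝓢(Space n, ℂ)) :
    ∫ x, moyal n θ a b x = ∫ x, a x * b x := by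
  simp_rw [moyal_eq_oscInt]
  rw [integral_const_mul, integral_oscInt _ (inner_invMap_self n θ), ← integral_const_mul]
  refine integral_congr_ae (Filter.Eventually.of_forall fun x => ?_)
  simp only
  set M' := ContinuousLinearMap.adjoint (invMap n θ) with hM'
  have hθ : ((Real.pi * θ : ℝ) : ℂ) ^ (2 * n) ≠ 0 :=
    pow_ne_zero _ (by exact_mod_cast mul_ne_zero Real.pi_ne_zero (NeZero.ne θ))
  have hdet := abs_det_adjoint_invMap n θ
  have hdet0 : M'.det ≠ 0 := by
    intro h
    rw [← hM', h, abs_zero, eq_comm, inv_eq_zero] at hdet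
    exact hθ (by exact_mod_cast hdet)
  have h1 : 𝓕⁻ (halfFourier n θ b : Space n → ℂ) (invMap n θ x) =
      ((Real.pi * θ : ℝ) : ℂ) ^ (2 * n) * b x := by
    have h2 : ∀ y, halfFourier n θ b y = (𝓕 b) (M' y) := fun y => rfl
    rw [Real.fourierInv_eq']
    have h3 : ∀ y : Space n, inner ℝ y (invMap n θ x) = inner ℝ (M' y) x := fun y => by
      rw [hM', ContinuousLinearMap.adjoint_inner_left]
    simp_rw [h2, h3]
    refine (integral_comp_continuousLinearMap M' hdet0 fun u =>
      Complex.exp (↑(2 * Real.pi * inner ℝ u x) * Complex.I) • (𝓕 b) u).trans ?_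
    rw [← Real.fourierInv_eq',
      ← SchwartzMap.fourierInv_coe, FourierTransform.fourierInv_fourier_eq, hdet, inv_inv]
    push_cast
    rfl
  rw [h1]
  field_simp

instance neZero_neg (θ : ℝ) [NeZero θ] : NeZero (-θ) :=
  ⟨neg_ne_zero.2 (NeZero.ne θ)⟩

/-- Since `Θ⁻¹` is antisymmetric, changing the sign of `θ` exchanges the roles of `y` and `z` in the
phase, and Fubini exchanges the integrals. The prefactor is an even power. -/
theorem moyal_neg (n : ℕ) (θ : ℝ) [NeZero θ] (a b : 𝓢(Space n, ℂ)) :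
    moyal n (-θ) a b = moyal n θ b a := by
  ext x
  change moyalIntegral n (-θ) a b x = moyalIntegral n θ b a x
  unfold moyalIntegral
  congr 1
  · rw [mul_neg, Complex.ofReal_neg, Even.neg_pow (even_two_mul n)]
  have hint : Integrable (fun p : Space n × Space n => a (x + p.1) * b (x + p.2) *
      Complex.exp (-Complex.I * 2 * (p.1.ofLp ⬝ᵥ ((Theta n (-θ))⁻¹).mulVec p.2.ofLp : ℝ)))
      (volume.prod volume) := by
    refine Integrable.mul_bdd (c := 1) ?_ ?_ ?_
    · exact (a.integrable.comp_add_left x).mul_prod (b.integrable.comp_add_left x)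
    · refine Continuous.aestronglyMeasurable ?_
      simp only [dotProduct, Matrix.mulVec]
      fun_prop
    · refine Filter.Eventually.of_forall fun p => ?_
      rw [show ∀ t : ℝ, -Complex.I * 2 * t = ((-2 * t : ℝ) : ℂ) * Complex.I from
        fun t => by push_cast; ring, Complex.norm_exp_ofReal_mul_I]
  rw [integral_integral_swap hint]
  refine integral_congr_ae (Filter.Eventually.of_forall fun z => ?_)
  refine integral_congr_ae (Filter.Eventually.of_forall fun y => ?_)
  simp only
  have h : y.ofLp ⬝ᵥ ((Theta n (-θ))⁻¹).mulVec z.ofLp =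
      z.ofLp ⬝ᵥ ((Theta n θ)⁻¹).mulVec y.ofLp := by
    rw [Theta_inv_neg, ← Theta_inv_transpose, Matrix.mulVec_transpose, dotProduct_comm,
      Matrix.dotProduct_mulVec]
  rw [h, mul_comm (a _)]

end Operators

open scoped LineDeriv

/-! ### Heisenberg relations. -/

section CommutationRelations

theorem coordMul_mul_comm (n : ℕ) (μ ν : Fin 2 × Fin n) :
    coordMul n μ * coordMul n ν = coordMul n ν * coordMul n μ := by
  ext a x
  change coordMul n μ (coordMul n ν a) x = coordMul n ν (coordMul n μ a) x
  simp only [coordMul_apply]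
  ring

theorem thetaDeriv_mul_comm (n : ℕ) (θ : ℝ) (μ ν : Fin 2 × Fin n) :
    thetaDeriv n θ μ * thetaDeriv n θ ν = thetaDeriv n θ ν * thetaDeriv n θ μ := by
  ext a x
  have h : ∀ u v : Space n, (∂_{u} (∂_{v} a : 𝓢(Space n, ℂ)) : 𝓢(Space n, ℂ)) x =
      fderiv ℝ (fderiv ℝ a) x u v := by
    intro u v
    rw [SchwartzMap.lineDerivOp_apply_eq_fderiv]
    have h1 : (∂_{v} a : 𝓢(Space n, ℂ)) = fun y => fderiv ℝ a y v :=
      funext fun y => SchwartzMap.lineDerivOp_apply_eq_fderiv v a y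
    rw [h1, fderiv_clm_apply (((a.smooth 2).fderiv_right (m := 1) (by norm_num)).differentiable
      one_ne_zero x) (differentiableAt_const v)]
    simp
  refine (h _ _).trans (Eq.trans ?_ (h _ _).symm)
  exact ((a.smooth 2).contDiffAt.isSymmSndFDerivAt (by simp)).eq _ _

theorem thetaDeriv_mul_coordMul (n : ℕ) (θ : ℝ) (μ ν : Fin 2 × Fin n) :
    thetaDeriv n θ μ * coordMul n ν = coordMul n ν * thetaDeriv n θ μ +
      (Theta n θ μ ν : ℂ) • 1 := by
  ext a x
  change (∂_{rowVec n θ μ} (coordMul n ν a) : 𝓢(Space n, ℂ)) x =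
    coordMul n ν (∂_{rowVec n θ μ} a) x + (Theta n θ μ ν : ℂ) * a x
  set C : Space n →L[ℝ] ℂ := Complex.ofRealCLM ∘L (EuclideanSpace.proj ν : Space n →L[ℝ] ℝ)
  have h1 : (coordMul n ν a : Space n → ℂ) = fun y => C y * a y :=
    funext fun y => coordMul_apply n ν a y
  rw [coordMul_apply, SchwartzMap.lineDerivOp_apply_eq_fderiv,
    SchwartzMap.lineDerivOp_apply_eq_fderiv, h1]
  have h2 : HasFDerivAt (fun y => C y * a y) (C x • fderiv ℝ a x + a x • C) x :=
    C.hasFDerivAt.mul (a.hasFDerivAt x)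
  rw [h2.fderiv]
  simp [C, rowVec, mul_comm]

theorem starCoord_mul_coordMul (n : ℕ) (θ : ℝ) (μ ν : Fin 2 × Fin n) :
    starCoord n θ μ * coordMul n ν - coordMul n ν * starCoord n θ μ =
      (Complex.I / 2 * Theta n θ μ ν) • 1 := by
  rw [starCoord, add_mul, mul_add, smul_mul_assoc, thetaDeriv_mul_coordMul, coordMul_mul_comm,
    mul_smul_comm, smul_add, smul_smul]
  abel

/-- Each of the two mixed commutators of a coordinate with a derivative contributes `(i/2) Θ_{μν}`.
-/
theorem starCoord_mul_starCoord (n : ℕ) (θ : ℝ) (μ ν : Fin 2 × Fin n) :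
    starCoord n θ μ * starCoord n θ ν - starCoord n θ ν * starCoord n θ μ =
      (Complex.I * Theta n θ μ ν) • 1 := by
  have h1 := thetaDeriv_mul_coordMul n θ μ ν
  have h2 := thetaDeriv_mul_coordMul n θ ν μ
  rw [Theta_swap, Complex.ofReal_neg] at h2
  simp only [starCoord, add_mul, mul_add, smul_mul_assoc, mul_smul_comm, h1, h2,
    coordMul_mul_comm n μ ν, thetaDeriv_mul_comm n θ μ ν]
  module

/-- Stated for two families, so that it covers both `starCoord` against `coordMul` and `starCoord`
against itself. -/
theorem commutator_affine {ι A : Type*} [Fintype ι] [Ring A] [Algebra ℂ A] (L N : ι → A)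
    (B : ι → ι → ℂ) (h : ∀ μ ν, L μ * N ν - N ν * L μ = B μ ν • (1 : A)) (c d : ℂ)
    (v w : ι → ℂ) :
    (c • 1 + ∑ μ, v μ • L μ) * (d • 1 + ∑ ν, w ν • N ν) -
      (d • 1 + ∑ ν, w ν • N ν) * (c • 1 + ∑ μ, v μ • L μ) =
      (∑ μ, ∑ ν, v μ * w ν * B μ ν) • (1 : A) := by
  have h1 : (∑ μ, v μ • L μ) * (∑ ν, w ν • N ν) - (∑ ν, w ν • N ν) * (∑ μ, v μ • L μ) =
      (∑ μ, ∑ ν, v μ * w ν * B μ ν) • (1 : A) := by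
    rw [Finset.sum_mul_sum, Finset.sum_mul_sum, Finset.sum_comm (s := Finset.univ (α := ι))
      (t := Finset.univ (α := ι)) (f := fun i j => w i • N i * v j • L j),
      ← Finset.sum_sub_distrib, Finset.sum_smul]
    refine Finset.sum_congr rfl fun μ _ => ?_
    rw [← Finset.sum_sub_distrib, Finset.sum_smul]
    refine Finset.sum_congr rfl fun ν _ => ?_
    rw [mul_smul, ← h, smul_mul_smul_comm, smul_mul_smul_comm, mul_comm (w ν), smul_sub]
  rw [← h1]
  simp only [add_mul, mul_add, smul_mul_assoc, mul_smul_comm, one_mul, mul_one]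
  module

end CommutationRelations

/-! ### Moyal and pointwise multiplication by affine functions. -/

section AffineFunctions

/-- The polynomial `c + ∑_μ v_μ x_μ`. -/
noncomputable def affPoly (n : ℕ) (c : ℂ) (v : Fin 2 × Fin n → ℂ) :
    MvPolynomial (Fin 2 × Fin n) ℂ :=
  MvPolynomial.C c + ∑ μ, v μ • MvPolynomial.X μ

/-- Pointwise multiplication by the affine function `c + ∑_μ v_μ x_μ`. -/
noncomputable def affMul (n : ℕ) (c : ℂ) (v : Fin 2 × Fin n → ℂ) :
    𝓢(Space n, ℂ) →L[ℂ] 𝓢(Space n, ℂ) :=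
  c • 1 + ∑ μ, v μ • coordMul n μ

/-- Left Moyal multiplication by the affine function `c + ∑_μ v_μ x_μ`. -/
noncomputable def affOp (n : ℕ) (θ : ℝ) (c : ℂ) (v : Fin 2 × Fin n → ℂ) :
    𝓢(Space n, ℂ) →L[ℂ] 𝓢(Space n, ℂ) :=
  c • 1 + ∑ μ, v μ • starCoord n θ μ

theorem affPoly_add (n : ℕ) (c d : ℂ) (v w : Fin 2 × Fin n → ℂ) :
    affPoly n (c + d) (v + w) = affPoly n c v + affPoly n d w := by
  simp only [affPoly, map_add, Pi.add_apply, add_smul, Finset.sum_add_distrib]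
  abel

theorem affOp_add (n : ℕ) (θ : ℝ) (c d : ℂ) (v w : Fin 2 × Fin n → ℂ) :
    affOp n θ (c + d) (v + w) = affOp n θ c v + affOp n θ d w := by
  simp only [affOp, Pi.add_apply, add_smul, Finset.sum_add_distrib]
  abel

theorem affMul_apply (n : ℕ) (c : ℂ) (v : Fin 2 × Fin n → ℂ) (a : 𝓢(Space n, ℂ)) (x : Space n) :
    affMul n c v a x = polyFun n (affPoly n c v) x * a x := by
  have h : affMul n c v a = c • a + ∑ μ, v μ • coordMul n μ a := by
    simp [affMul, sum_apply]
  rw [h]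
  simp [polyFun, affPoly, coordMul_apply, add_mul, Finset.sum_mul, mul_assoc, MvPolynomial.smul_eval]

theorem affOp_mul_affMul (n : ℕ) (θ : ℝ) (c : ℂ) (v : Fin 2 × Fin n → ℂ) :
    affOp n θ c v * affMul n c v = affMul n c v * affOp n θ c v := by
  have h := commutator_affine _ _ _ (starCoord_mul_coordMul n θ) c c v v
  -- The antisymmetric form `Θ` vanishes on the pair `(v, v)`; this is why equal affine functions
  -- are needed.
  have h0 : ∑ μ, ∑ ν, v μ * v ν * (Complex.I / 2 * Theta n θ μ ν) = 0 := by
    have h1 : ∑ μ, ∑ ν, v μ * v ν * (Complex.I / 2 * Theta n θ μ ν) =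
        -∑ μ, ∑ ν, v μ * v ν * (Complex.I / 2 * Theta n θ μ ν) := by
      conv_lhs => rw [Finset.sum_comm]
      simp only [← Finset.sum_neg_distrib]
      refine Finset.sum_congr rfl fun μ _ => Finset.sum_congr rfl fun ν _ => ?_
      rw [Theta_swap]
      push_cast
      ring
    exact self_eq_neg.1 h1
  rw [h0, zero_smul] at h
  exact sub_eq_zero.1 h

theorem affOp_commutator (n : ℕ) (θ : ℝ) (c d : ℂ) (v w : Fin 2 × Fin n → ℂ) :
    affOp n θ c v * affOp n θ d w - affOp n θ d w * affOp n θ c v =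
      (Complex.I * ∑ μ, ∑ ν, v μ * w ν * Theta n θ μ ν) • 1 := by
  refine (commutator_affine _ _ _ (starCoord_mul_starCoord n θ) c d v w).trans ?_
  congr 1
  simp only [Finset.mul_sum]
  refine Finset.sum_congr rfl fun μ _ => Finset.sum_congr rfl fun ν _ => ?_
  ring

theorem poissonBracket_affPoly_sq (n : ℕ) (θ : ℝ) (c d : ℂ) (v w : Fin 2 × Fin n → ℂ) :
    poissonBracket n θ (affPoly n c v ^ 2) (affPoly n d w ^ 2) =
      (4 * ∑ μ, ∑ ν, v μ * w ν * Theta n θ μ ν) • (affPoly n c v * affPoly n d w) := by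
  have h : ∀ (c : ℂ) (v : Fin 2 × Fin n → ℂ) μ, MvPolynomial.pderiv μ (affPoly n c v ^ 2) =
      (2 * v μ) • affPoly n c v := by
    intro c v μ
    have h1 : MvPolynomial.pderiv μ (affPoly n c v) = MvPolynomial.C (v μ) := by
      simp only [affPoly, map_add, map_sum, MvPolynomial.pderiv_C, zero_add]
      simp [Pi.single_apply, MvPolynomial.smul_eq_C_mul]
    rw [pow_two, Derivation.leibniz, h1, MvPolynomial.smul_eq_C_mul]
    simp only [smul_eq_mul, map_mul, map_ofNat]
    ring
  simp only [poissonBracket, h]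
  rw [Finset.mul_sum, Finset.sum_smul]
  refine Finset.sum_congr rfl fun μ _ => ?_
  rw [Finset.mul_sum, Finset.sum_smul]
  refine Finset.sum_congr rfl fun ν _ => ?_
  rw [smul_mul_smul_comm, smul_smul]
  congr 1
  ring

/-- Integration by parts against the constant function `1`. -/
theorem integral_thetaDeriv (n : ℕ) (θ : ℝ) (μ : Fin 2 × Fin n) (a : 𝓢(Space n, ℂ)) :
    ∫ x, thetaDeriv n θ μ a x = 0 := by
  have h := integral_bilinear_hasLineDerivAt_right_eq_neg_left_of_integrable
    (μ := (volume : Measure (Space n))) (f := fun _ => (1 : ℂ)) (f' := fun _ => 0)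
    (g := a) (g' := thetaDeriv n θ μ a) (v := rowVec n θ μ) (B := ContinuousLinearMap.mul ℝ ℂ)
    (by simp) (by simpa using (thetaDeriv n θ μ a).integrable) (by simpa using a.integrable)
    (fun x _ => (hasFDerivAt_const (1 : ℂ) x).hasLineDerivAt _)
    (fun x _ => (a.hasFDerivAt x).hasLineDerivAt _)
  simpa using h

theorem integral_starCoord (n : ℕ) (θ : ℝ) (μ : Fin 2 × Fin n) (a : 𝓢(Space n, ℂ)) :
    ∫ x, starCoord n θ μ a x = ∫ x, coordMul n μ a x := by
  have h : ∀ x, starCoord n θ μ a x = coordMul n μ a x +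
    Complex.I / 2 * thetaDeriv n θ μ a x := fun x => rfl
  simp_rw [h]
  rw [integral_add (coordMul n μ a).integrable ((thetaDeriv n θ μ a).integrable.const_mul _),
    integral_const_mul, integral_thetaDeriv, mul_zero, add_zero]

theorem integral_affOp (n : ℕ) (θ : ℝ) (c : ℂ) (v : Fin 2 × Fin n → ℂ) (a : 𝓢(Space n, ℂ)) :
    ∫ x, affOp n θ c v a x = ∫ x, affMul n c v a x := by
  have h : ∀ b : 𝓢(Space n, ℂ), ∫ x, b x = SchwartzMap.integralCLM ℂ volume b := fun b => rfl
  simp_rw [h, affOp, affMul, add_apply, sum_apply, smul_apply, map_add, map_sum, map_smul, ← h,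
    integral_starCoord]

theorem affOp_moyal (n : ℕ) (θ : ℝ) [NeZero θ] (c : ℂ) (v : Fin 2 × Fin n → ℂ)
    (a b : 𝓢(Space n, ℂ)) :
    affOp n θ c v (moyal n θ a b) = moyal n θ (affOp n θ c v a) b := by
  rw [← rightMulCLM_eq, ← rightMulCLM_eq]
  have h := starCoord_moyal n θ
  simp_rw [← rightMulCLM_eq] at h
  simp [affOp, sum_apply, h]

end AffineFunctions

/-! ### Distributions represented by operators, and their products. -/

section Representation

/-- The operator `A` is left Moyal multiplication by the distribution `T`, see `distMul_eq`. -/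
structure Represents (n : ℕ) (θ : ℝ) [NeZero θ] (T : 𝓢'(Space n, ℂ))
    (A : 𝓢(Space n, ℂ) →L[ℂ] 𝓢(Space n, ℂ)) : Prop where
  apply_eq : ∀ a, T a = ∫ x, A a x
  map_moyal : ∀ a b, A (moyal n θ a b) = moyal n θ (A a) b

theorem schwartzToDist_apply (n : ℕ) (c b : 𝓢(Space n, ℂ)) :
    schwartzToDist n c b = ∫ x, b x * c x :=
  rfl

variable {n : ℕ} {θ : ℝ} [NeZero θ] {S T : 𝓢'(Space n, ℂ)}
  {A B A' B' : 𝓢(Space n, ℂ) →L[ℂ] 𝓢(Space n, ℂ)}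

theorem mulDist_eq_distMul (a : 𝓢(Space n, ℂ)) : mulDist n θ a T = distMul n (-θ) a T := by
  ext b
  rw [mulDist_apply, distMul_apply, moyal_neg]

theorem Represents.apply_moyal (h : Represents n θ T A) (a b : 𝓢(Space n, ℂ)) :
    T (moyal n θ a b) = ∫ x, A a x * b x := by
  rw [h.apply_eq, h.map_moyal, integral_moyal]

theorem Represents.distMul_eq (h : Represents n θ T A) (a : 𝓢(Space n, ℂ)) :
    distMul n θ a T = schwartzToDist n (A a) := by
  ext b
  rw [distMul_apply, h.apply_moyal, schwartzToDist_apply]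
  simp_rw [mul_comm]

theorem Represents.mem_moyalAlgebra (h : Represents n θ T A) (h' : Represents n (-θ) T A') :
    T ∈ moyalAlgebra n θ := by
  rw [Moyal.mem_moyalAlgebra]
  exact ⟨fun a => ⟨A' a, by rw [mulDist_eq_distMul, h'.distMul_eq]⟩,
    fun a => ⟨A a, (h.distMul_eq a).symm⟩⟩

theorem Represents.leftAction_eq (h : Represents n θ T A) (hT : T ∈ moyalAlgebra n θ)
    (a : 𝓢(Space n, ℂ)) : leftAction n θ ⟨T, hT⟩ a = A a :=
  schwartzToDist_injective n ((schwartzToDist_leftAction n θ ⟨T, hT⟩ a).trans (h.distMul_eq a))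

theorem Represents.moyalMul_eq (h : Represents n θ T A) (hS : S ∈ moyalAlgebra n θ)
    (hT : T ∈ moyalAlgebra n θ) (a : 𝓢(Space n, ℂ)) :
    moyalMul n θ ⟨S, hS⟩ ⟨T, hT⟩ a = S (A a) := by
  rw [← h.leftAction_eq hT]
  rfl

/-- The functional `S ∘ B` is `S ⋆ T`. It acts on one side by `A B` and on the other by `B' A'`. -/
theorem Represents.comp_mem_moyalAlgebra (hS : Represents n θ S A)
    (hS' : Represents n (-θ) S A') (hT : Represents n θ T B)
    (hT' : Represents n (-θ) T B') :
    PointwiseConvergenceCLM.precomp ℂ B S ∈ moyalAlgebra n θ := by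
  rw [Moyal.mem_moyalAlgebra]
  refine ⟨fun a => ⟨B' (A' a), ?_⟩, fun a => ⟨A (B a), ?_⟩⟩
  · ext b
    rw [mulDist_apply, schwartzToDist_apply]
    change _ = S (B (moyal n θ b a))
    rw [hT.map_moyal, ← moyal_neg, hS'.apply_moyal, ← integral_moyal n (-θ), moyal_neg]
    -- Evaluating `T (b ⋆ A' a)` with `B` and with `B'` shows that `B'` is the transpose of `B` for
    -- the pairing `∫ a b`.
    have h := hT.apply_moyal b (A' a)
    rw [← moyal_neg, hT'.apply_moyal] at h
    rw [← integral_moyal n θ] at h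
    simpa [mul_comm, integral_moyal] using h
  · ext b
    rw [distMul_apply, schwartzToDist_apply]
    change _ = S (B (moyal n θ a b))
    rw [hT.map_moyal, hS.apply_moyal]
    simp_rw [mul_comm]

theorem Represents.eq_zero (h : Represents n θ T 0) : T = 0 := by
  ext a
  rw [h.apply_eq]
  simp

end Representation

/-! ### Quadratic polynomials paired with their operators. -/

section QuadraticPolynomials

variable (n : ℕ) (θ : ℝ)

theorem polyFun_mul (p q : MvPolynomial (Fin 2 × Fin n) ℂ) (x : Space n) :
    polyFun n (p * q) x = polyFun n p x * polyFun n q x := by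
  simp [polyFun]

/-- With `L = affOp` and `M = affMul`: `∫ L L a = ∫ M L a = ∫ L M a = ∫ M M a`. -/
theorem represents_affPoly_sq [NeZero θ] (c : ℂ) (v : Fin 2 × Fin n → ℂ) :
    Represents n θ (polyDist n (affPoly n c v ^ 2)) (affOp n θ c v ^ 2) where
  apply_eq a := by
    have h1 : ∀ x, a x * polyFun n (affPoly n c v ^ 2) x = affMul n c v (affMul n c v a) x := by
      intro x
      rw [affMul_apply, affMul_apply, pow_two, polyFun_mul]
      ring
    have h2 : affMul n c v (affOp n θ c v a) = affOp n θ c v (affMul n c v a) :=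
      (DFunLike.congr_fun (affOp_mul_affMul n θ c v) a).symm
    rw [polyDist_apply, pow_two (affOp n θ c v)]
    simp_rw [h1]
    change _ = ∫ x, affOp n θ c v (affOp n θ c v a) x
    rw [integral_affOp, h2, integral_affOp]
  map_moyal a b := by
    rw [pow_two]
    change affOp n θ c v (affOp n θ c v (moyal n θ a b)) =
      moyal n θ (affOp n θ c v (affOp n θ c v a)) b
    rw [affOp_moyal, affOp_moyal]

/-- The Poisson bracket as a bilinear map. -/
noncomputable def poissonBilin : MvPolynomial (Fin 2 × Fin n) ℂ →ₗ[ℂ]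
    MvPolynomial (Fin 2 × Fin n) ℂ →ₗ[ℂ] MvPolynomial (Fin 2 × Fin n) ℂ :=
  LinearMap.mk₂ ℂ (poissonBracket n θ)
    (fun p q r => by simp [poissonBracket, add_mul, Finset.sum_add_distrib])
    (fun c p q => by
      simp only [poissonBracket, Finset.smul_sum, Derivation.map_smul, smul_mul_assoc]
      simp_rw [smul_comm c])
    (fun p q r => by simp [poissonBracket, mul_add, Finset.sum_add_distrib])
    (fun c p q => by
      simp only [poissonBracket, Finset.smul_sum, Derivation.map_smul, mul_smul_comm]
      simp_rw [smul_comm c])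

theorem poissonBilin_apply (p q : MvPolynomial (Fin 2 × Fin n) ℂ) :
    poissonBilin n θ p q = poissonBracket n θ p q :=
  rfl

/-- The pairs of a quadratic polynomial and the operator of left Moyal multiplication by it,
as the span of the pairs for squares of affine functions. -/
noncomputable def quadPairs :
    Submodule ℂ (MvPolynomial (Fin 2 × Fin n) ℂ × (𝓢(Space n, ℂ) →L[ℂ] 𝓢(Space n, ℂ))) :=
  Submodule.span ℂ (Set.range fun u : ℂ × (Fin 2 × Fin n → ℂ) =>
    (affPoly n u.1 u.2 ^ 2, affOp n θ u.1 u.2 ^ 2))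

variable {n θ}

theorem sq_mem_quadPairs (c : ℂ) (v : Fin 2 × Fin n → ℂ) :
    (affPoly n c v ^ 2, affOp n θ c v ^ 2) ∈ quadPairs n θ :=
  Submodule.subset_span ⟨(c, v), rfl⟩

theorem represents_of_mem_quadPairs [NeZero θ]
    {z : MvPolynomial (Fin 2 × Fin n) ℂ × (𝓢(Space n, ℂ) →L[ℂ] 𝓢(Space n, ℂ))}
    (hz : z ∈ quadPairs n θ) : Represents n θ (polyDist n z.1) z.2 := by
  have hi : ∀ b : 𝓢(Space n, ℂ), ∫ x, b x = SchwartzMap.integralCLM ℂ volume b := fun b => rfl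
  induction hz using Submodule.span_induction with
  | mem z hz =>
    obtain ⟨u, rfl⟩ := hz
    exact represents_affPoly_sq n θ u.1 u.2
  | zero =>
    refine ⟨fun a => ?_, fun a b => ?_⟩
    · simp
    · simp only [Prod.snd_zero, zero_apply, ← rightMulCLM_eq, map_zero]
  | add y z _ _ hy hz =>
    refine ⟨fun a => ?_, fun a b => ?_⟩
    · rw [hi, Prod.snd_add, add_apply, map_add, ← hi, ← hi, ← hy.apply_eq, ← hz.apply_eq,
        Prod.fst_add, map_add]
      rfl
    · rw [Prod.snd_add, add_apply, hy.map_moyal, hz.map_moyal, add_apply]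
      simp only [← rightMulCLM_eq, map_add]
  | smul c z _ hz =>
    refine ⟨fun a => ?_, fun a b => ?_⟩
    · rw [hi, Prod.smul_snd, smul_apply, map_smul, ← hi, ← hz.apply_eq, Prod.smul_fst, map_smul]
      rfl
    · rw [Prod.smul_snd, smul_apply, hz.map_moyal, smul_apply]
      simp only [← rightMulCLM_eq, map_smul]

/-- Polarization, `(f + g)² - f² - g²`, in both components; on operators it produces the symmetrized
product. -/
theorem mul_mem_quadPairs (c d : ℂ) (v w : Fin 2 × Fin n → ℂ) :
    ((2 : ℂ) • (affPoly n c v * affPoly n d w),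
      affOp n θ c v * affOp n θ d w + affOp n θ d w * affOp n θ c v) ∈ quadPairs n θ := by
  have h := (quadPairs n θ).sub_mem ((quadPairs n θ).sub_mem
    (sq_mem_quadPairs (θ := θ) (c + d) (v + w)) (sq_mem_quadPairs c v)) (sq_mem_quadPairs d w)
  convert! h using 1
  rw [affPoly_add, affOp_add]
  refine Prod.ext ?_ ?_
  · rw [MvPolynomial.smul_eq_C_mul, map_ofNat]
    simp only [Prod.fst_sub]
    ring
  · simp only [Prod.snd_sub]
    noncomm_ring

theorem poissonBracket_mem_quadPairs
    {y z : MvPolynomial (Fin 2 × Fin n) ℂ × (𝓢(Space n, ℂ) →L[ℂ] 𝓢(Space n, ℂ))}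
    (hy : y ∈ quadPairs n θ) (hz : z ∈ quadPairs n θ) :
    (Complex.I • poissonBilin n θ y.1 z.1, y.2 * z.2 - z.2 * y.2) ∈ quadPairs n θ := by
  induction hy, hz using Submodule.span_induction₂ with
  | mem_mem y z hy hz =>
    obtain ⟨⟨c, v⟩, rfl⟩ := hy
    obtain ⟨⟨d, w⟩, rfl⟩ := hz
    -- With `[F, G] = k`, both `[F², G²] = 2k (FG + GF)` and `i {f², g²} = 2k (2 f g)` are `2k`
    -- times the polarized pair.
    have h := (quadPairs n θ).smul_mem (2 * (Complex.I * ∑ μ, ∑ ν, v μ * w ν * Theta n θ μ ν))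
      (mul_mem_quadPairs (θ := θ) c d v w)
    have hc := affOp_commutator n θ c d v w
    set k := Complex.I * ∑ μ, ∑ ν, v μ * w ν * Theta n θ μ ν with hk
    convert! h using 1
    refine Prod.ext ?_ ?_
    · simp only [poissonBilin_apply, poissonBracket_affPoly_sq, Prod.smul_fst, smul_smul, hk]
      congr 1
      ring
    · simp only [Prod.smul_snd]
      generalize affOp n θ c v = F at *
      generalize affOp n θ d w = G at *
      have h1 : F ^ 2 * G ^ 2 - G ^ 2 * F ^ 2 = F * (F * G - G * F) * G + F * G * (F * G - G * F)
          + (F * G - G * F) * G * F + G * (F * G - G * F) * F := by noncomm_ring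
      rw [h1, hc]
      simp only [smul_mul_assoc, mul_smul_comm, mul_one, one_mul]
      module
  | zero_left y =>
    convert! (quadPairs n θ).zero_mem using 1
    exact Prod.ext (by simp) (by simp)
  | zero_right y =>
    convert! (quadPairs n θ).zero_mem using 1
    exact Prod.ext (by simp) (by simp)
  | add_left x y z _ _ _ hx hy =>
    convert! (quadPairs n θ).add_mem hx hy using 1
    refine Prod.ext ?_ ?_
    · simp
    · simp only [Prod.snd_add]
      noncomm_ring
  | add_right x y z _ _ _ hx hy =>
    convert! (quadPairs n θ).add_mem hx hy using 1
    refine Prod.ext ?_ ?_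
    · simp
    · simp only [Prod.snd_add]
      noncomm_ring
  | smul_left r x y _ _ h =>
    convert! (quadPairs n θ).smul_mem r h using 1
    refine Prod.ext ?_ ?_
    · simp [smul_comm r]
    · simp [smul_sub]
  | smul_right r x y _ _ h =>
    convert! (quadPairs n θ).smul_mem r h using 1
    refine Prod.ext ?_ ?_
    · simp [smul_comm r]
    · simp [smul_sub]

theorem totalDegree_affPoly_le (c : ℂ) (v : Fin 2 × Fin n → ℂ) :
    (affPoly n c v).totalDegree ≤ 1 := by
  refine (MvPolynomial.totalDegree_add _ _).trans (max_le (by simp) ?_)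
  refine (MvPolynomial.totalDegree_finsetSum _ _).trans (Finset.sup_le fun μ _ => ?_)
  exact (MvPolynomial.totalDegree_smul_le _ _).trans (by simp)

theorem fst_mem_restrictTotalDegree
    {z : MvPolynomial (Fin 2 × Fin n) ℂ × (𝓢(Space n, ℂ) →L[ℂ] 𝓢(Space n, ℂ))}
    (hz : z ∈ quadPairs n θ) : z.1 ∈ MvPolynomial.restrictTotalDegree (Fin 2 × Fin n) ℂ 2 := by
  have h : quadPairs n θ ≤ (MvPolynomial.restrictTotalDegree (Fin 2 × Fin n) ℂ 2).comap
      (LinearMap.fst ℂ _ _) := by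
    refine Submodule.span_le.2 ?_
    rintro _ ⟨u, rfl⟩
    refine (MvPolynomial.mem_restrictTotalDegree _ _ _).2 ?_
    refine (MvPolynomial.totalDegree_pow _ _).trans ?_
    have := totalDegree_affPoly_le u.1 u.2
    omega
  exact h hz

theorem affPoly_mul_mem_map_fst (c d : ℂ) (v w : Fin 2 × Fin n → ℂ) :
    affPoly n c v * affPoly n d w ∈ (quadPairs n θ).map (LinearMap.fst ℂ _ _) := by
  refine ⟨(2⁻¹ : ℂ) • _, (quadPairs n θ).smul_mem _ (mul_mem_quadPairs c d v w), ?_⟩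
  simp [smul_smul]

/-- Every monomial of degree at most two is a product of two affine polynomials: `1 * 1`, `X_μ * 1`
or `X_μ * X_ν`. -/
theorem exists_mem_quadPairs (θ : ℝ) {p : MvPolynomial (Fin 2 × Fin n) ℂ}
    (hp : p ∈ MvPolynomial.restrictTotalDegree (Fin 2 × Fin n) ℂ 2) :
    ∃ A, (p, A) ∈ quadPairs n θ := by
  have hone : affPoly n 1 0 = 1 := by simp [affPoly]
  have hX : ∀ μ, affPoly n 0 (Pi.single μ 1) = MvPolynomial.X μ := by
    intro μ
    simp [affPoly, Pi.single_apply]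
  suffices h : p ∈ (quadPairs n θ).map (LinearMap.fst ℂ _ _) by
    obtain ⟨z, hz, rfl⟩ := h
    exact ⟨z.2, hz⟩
  rw [p.as_sum]
  refine Submodule.sum_mem _ fun s hs => ?_
  have hdeg : s.degree ≤ 2 :=
    (MvPolynomial.le_totalDegree hs).trans ((MvPolynomial.mem_restrictTotalDegree _ _ _).1 hp)
  rw [← mul_one (p.coeff s), ← smul_eq_mul, ← MvPolynomial.smul_monomial]
  refine Submodule.smul_mem _ _ ?_
  have hsplit : ∀ t : Fin 2 × Fin n →₀ ℕ, t ≠ 0 → ∃ μ t', t = Finsupp.single μ 1 + t' ∧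
      t.degree = 1 + t'.degree := by
    intro t ht
    obtain ⟨μ, hμ⟩ := Finsupp.ne_iff.1 ht
    have h1 : Finsupp.single μ 1 ≤ t := by
      rw [Finsupp.single_le_iff]
      exact Nat.one_le_iff_ne_zero.2 hμ
    refine ⟨μ, t - Finsupp.single μ 1, (add_tsub_cancel_of_le h1).symm, ?_⟩
    conv_lhs => rw [← add_tsub_cancel_of_le h1]
    simp
  have hmon : ∀ μ (t : Fin 2 × Fin n →₀ ℕ), MvPolynomial.monomial (Finsupp.single μ 1 + t)
      (1 : ℂ) = MvPolynomial.X μ * MvPolynomial.monomial t 1 := by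
    intro μ t
    rw [MvPolynomial.X, MvPolynomial.monomial_mul, one_mul]
  by_cases h0 : s = 0
  · have := affPoly_mul_mem_map_fst (θ := θ) 1 1 (0 : Fin 2 × Fin n → ℂ) 0
    rw [hone, one_mul] at this
    rw [h0]
    exact this
  obtain ⟨μ, t, rfl, ht⟩ := hsplit s h0
  rw [hmon, ← hX]
  by_cases h1 : t = 0
  · have := affPoly_mul_mem_map_fst (θ := θ) 0 1 (Pi.single μ 1 : Fin 2 × Fin n → ℂ) 0
    rw [hone] at this
    rw [h1]
    exact this
  obtain ⟨ν, r, rfl, hr⟩ := hsplit t h1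
  have h2 : r = 0 := (Finsupp.degree_eq_zero_iff r).1 (by omega)
  subst h2
  rw [hmon, ← hX]
  have h3 : MvPolynomial.monomial (0 : Fin 2 × Fin n →₀ ℕ) (1 : ℂ) = 1 := rfl
  rw [h3, mul_one]
  exact affPoly_mul_mem_map_fst _ _ _ _

end QuadraticPolynomials

/-! ### Transfer from polynomials to distributions, and the Lie algebra structure. -/

theorem polyDist_injective (n : ℕ) : Function.Injective (polyDist n) := by
  refine (injective_iff_map_eq_zero _).2 fun p hp => ?_
  have hcont : Continuous (polyFun n p) := (polyFun_hasTemperateGrowth n p).1.continuous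
  have hae : ∀ᵐ x : Space n, polyFun n p x = 0 := by
    refine ae_eq_zero_of_integral_contDiff_smul_eq_zero hcont.locallyIntegrable fun g hg hs => ?_
    have hs' : HasCompactSupport fun x => (g x : ℂ) := hs.comp_left Complex.ofReal_zero
    have h : ∫ x, (g x : ℂ) * polyFun n p x = 0 :=
      congrArg (fun T : 𝓢'(Space n, ℂ) =>
        T (hs'.toSchwartzMap (Complex.ofRealCLM.contDiff.comp hg))) hp
    simpa using h
  have h0 : polyFun n p = 0 := (hcont.ae_eq_iff_eq volume continuous_const).1 hae
  -- A complex polynomial vanishing at all real points is zero because `ℝ` is infinite.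
  refine MvPolynomial.funext_set (fun _ => Set.range ((↑) : ℝ → ℂ))
    (fun _ => Set.infinite_range_of_injective Complex.ofReal_injective) fun x hx => ?_
  choose y hy using fun μ => hx μ (Set.mem_univ μ)
  have h1 := congrFun h0 (WithLp.toLp 2 y)
  simp only [polyFun, hy] at h1
  rw [map_zero]
  exact h1

variable {n : ℕ} {θ : ℝ}

theorem exists_represents (θ : ℝ) [NeZero θ] {T : 𝓢'(Space n, ℂ)} (hT : T ∈ polyTwo n) :
    ∃ A, Represents n θ T A := by
  obtain ⟨p, hp, rfl⟩ := hT
  obtain ⟨A, hA⟩ := exists_mem_quadPairs θ hp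
  have h := represents_of_mem_quadPairs hA
  exact ⟨A, h⟩

theorem polyTwo_le_moyalAlgebra (n : ℕ) (θ : ℝ) [NeZero θ] : polyTwo n ≤ moyalAlgebra n θ := by
  intro T hT
  obtain ⟨A, hA⟩ := exists_represents θ hT
  obtain ⟨A', hA'⟩ := exists_represents (-θ) hT
  exact hA.mem_moyalAlgebra hA'

/-- Here `⟨P ⋆ Q, a⟩ = P (B a) = ∫ A (B a)`, so the bracket is represented by the commutator `A B -
B A`. -/
theorem moyalBracket_polyDist [NeZero θ] {p q : MvPolynomial (Fin 2 × Fin n) ℂ}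
    (hp : p ∈ MvPolynomial.restrictTotalDegree (Fin 2 × Fin n) ℂ 2)
    (hq : q ∈ MvPolynomial.restrictTotalDegree (Fin 2 × Fin n) ℂ 2)
    (hP : polyDist n p ∈ moyalAlgebra n θ) (hQ : polyDist n q ∈ moyalAlgebra n θ)
    (a : 𝓢(Space n, ℂ)) :
    moyalBracket n θ ⟨polyDist n p, hP⟩ ⟨polyDist n q, hQ⟩ a =
      polyDist n (Complex.I • poissonBracket n θ p q) a := by
  obtain ⟨A, hA⟩ := exists_mem_quadPairs θ hp
  obtain ⟨B, hB⟩ := exists_mem_quadPairs θ hq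
  have hpA := represents_of_mem_quadPairs hA
  have hqB := represents_of_mem_quadPairs hB
  have h := (represents_of_mem_quadPairs (poissonBracket_mem_quadPairs hA hB)).apply_eq a
  rw [poissonBilin_apply] at h
  rw [h, moyalBracket, LinearMap.sub_apply, hqB.moyalMul_eq, hpA.moyalMul_eq, hpA.apply_eq,
    hqB.apply_eq]
  exact (integral_sub (A (B a)).integrable (B (A a)).integrable).symm

theorem smul_poissonBracket_mem (θ : ℝ) {p q : MvPolynomial (Fin 2 × Fin n) ℂ}
    (hp : p ∈ MvPolynomial.restrictTotalDegree (Fin 2 × Fin n) ℂ 2)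
    (hq : q ∈ MvPolynomial.restrictTotalDegree (Fin 2 × Fin n) ℂ 2) :
    Complex.I • poissonBilin n θ p q ∈ MvPolynomial.restrictTotalDegree (Fin 2 × Fin n) ℂ 2 := by
  obtain ⟨A, hA⟩ := exists_mem_quadPairs θ hp
  obtain ⟨B, hB⟩ := exists_mem_quadPairs θ hq
  exact fst_mem_restrictTotalDegree (poissonBracket_mem_quadPairs hA hB)

/-- The bracket `i {·, ·}` on polynomials of degree at most `2`. -/
noncomputable def quadBracket (n : ℕ) (θ : ℝ) :
    MvPolynomial.restrictTotalDegree (Fin 2 × Fin n) ℂ 2 →ₗ[ℂ]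
      MvPolynomial.restrictTotalDegree (Fin 2 × Fin n) ℂ 2 →ₗ[ℂ]
        MvPolynomial.restrictTotalDegree (Fin 2 × Fin n) ℂ 2 :=
  LinearMap.mk₂ ℂ (fun p q => ⟨Complex.I • poissonBilin n θ p q,
      smul_poissonBracket_mem θ p.2 q.2⟩)
    (fun p q r => Subtype.ext (by simp))
    (fun c p q => Subtype.ext (by simp [smul_comm c]))
    (fun p q r => Subtype.ext (by simp))
    (fun c p q => Subtype.ext (by simp [smul_comm c]))

theorem isLieBracket_quadBracket (n : ℕ) (θ : ℝ) [NeZero θ] : IsLieBracket (quadBracket n θ) := by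
  -- The operator determines the polynomial, so identities of commutators in an associative algebra
  -- transfer to the bracket on polynomials.
  have key : ∀ p : MvPolynomial (Fin 2 × Fin n) ℂ, (p, 0) ∈ quadPairs n θ → p = 0 := by
    intro p hp
    exact polyDist_injective n
      ((represents_of_mem_quadPairs hp).eq_zero.trans (map_zero (polyDist n)).symm)
  refine ⟨fun x => Subtype.ext (key _ ?_), fun x y z => Subtype.ext (key _ ?_)⟩
  · obtain ⟨A, hA⟩ := exists_mem_quadPairs θ x.2
    have h := poissonBracket_mem_quadPairs hA hA
    rw [sub_self] at h
    exact h
  · obtain ⟨A, hA⟩ := exists_mem_quadPairs θ x.2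
    obtain ⟨B, hB⟩ := exists_mem_quadPairs θ y.2
    obtain ⟨C, hC⟩ := exists_mem_quadPairs θ z.2
    have h := (quadPairs n θ).add_mem ((quadPairs n θ).add_mem
      (poissonBracket_mem_quadPairs hA (poissonBracket_mem_quadPairs hB hC))
      (poissonBracket_mem_quadPairs hB (poissonBracket_mem_quadPairs hC hA)))
      (poissonBracket_mem_quadPairs hC (poissonBracket_mem_quadPairs hA hB))
    convert! h using 1
    refine Prod.ext rfl ?_
    simp only [Prod.snd_add]
    noncomm_ring

/-- The space `𝒫₂` is linearly equivalent to the polynomials of degree at most `2`. -/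
noncomputable def polyTwoEquiv (n : ℕ) :
    MvPolynomial.restrictTotalDegree (Fin 2 × Fin n) ℂ 2 ≃ₗ[ℂ] polyTwo n :=
  Submodule.equivMapOfInjective (polyDist n) (polyDist_injective n) _

theorem coe_polyTwoEquiv (p : MvPolynomial.restrictTotalDegree (Fin 2 × Fin n) ℂ 2) :
    (polyTwoEquiv n p : 𝓢'(Space n, ℂ)) = polyDist n p :=
  rfl

/-- The Moyal bracket on `𝒫₂`. -/
noncomputable def polyTwoBracket (n : ℕ) (θ : ℝ) :
    polyTwo n →ₗ[ℂ] polyTwo n →ₗ[ℂ] polyTwo n :=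
  ((quadBracket n θ).compl₁₂ (polyTwoEquiv n).symm.toLinearMap
    (polyTwoEquiv n).symm.toLinearMap).compr₂ (polyTwoEquiv n).toLinearMap

theorem polyTwoBracket_apply (P Q : polyTwo n) : polyTwoBracket n θ P Q =
    polyTwoEquiv n (quadBracket n θ ((polyTwoEquiv n).symm P) ((polyTwoEquiv n).symm Q)) :=
  rfl

theorem isLieBracket_polyTwoBracket (n : ℕ) (θ : ℝ) [NeZero θ] :
    IsLieBracket (polyTwoBracket n θ) := by
  obtain ⟨h1, h2⟩ := isLieBracket_quadBracket n θ
  refine ⟨fun P => ?_, fun P Q R => ?_⟩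
  · rw [polyTwoBracket_apply, h1, map_zero]
  · simp only [polyTwoBracket_apply, LinearEquiv.symm_apply_apply]
    rw [← map_add, ← map_add, h2, map_zero]

/-- No degree bound on `p` and `q` is assumed: injectivity of `polyDist` identifies them with the
quadratic polynomials defining `P` and `Q`. -/
theorem moyalBracket_eq_smul_poissonBracket [NeZero θ] (P Q : polyTwo n)
    (p q : MvPolynomial (Fin 2 × Fin n) ℂ) (hp : polyDist n p = P) (hq : polyDist n q = Q)
    (hP : P.1 ∈ moyalAlgebra n θ) (hQ : Q.1 ∈ moyalAlgebra n θ) (a : 𝓢(Space n, ℂ)) :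
    moyalBracket n θ ⟨P, hP⟩ ⟨Q, hQ⟩ a =
      polyDist n (Complex.I • poissonBracket n θ p q) a := by
  obtain ⟨P, p', hp', rfl⟩ := P
  obtain ⟨Q, q', hq', rfl⟩ := Q
  obtain rfl := polyDist_injective n hp
  obtain rfl := polyDist_injective n hq
  exact moyalBracket_polyDist hp' hq' hP hQ a

theorem moyalBracket_eq_polyTwoBracket [NeZero θ] (P Q : polyTwo n) (hP : P.1 ∈ moyalAlgebra n θ)
    (hQ : Q.1 ∈ moyalAlgebra n θ) (a : 𝓢(Space n, ℂ)) :
    moyalBracket n θ ⟨P, hP⟩ ⟨Q, hQ⟩ a = (polyTwoBracket n θ P Q : 𝓢'(Space n, ℂ)) a := by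
  have h : ∀ P : polyTwo n, polyDist n ((polyTwoEquiv n).symm P) = P := fun P => by
    rw [← coe_polyTwoEquiv, LinearEquiv.apply_symm_apply]
  rw [moyalBracket_eq_smul_poissonBracket P Q _ _ (h P) (h Q) hP hQ]
  rfl

end Moyal

theorem mainTheorem5 (n : ℕ) (θ : ℝ) [NeZero θ] :
    ∃ hP : Moyal.polyTwo n ≤ Moyal.moyalAlgebra n θ,
      (∀ P Q : Moyal.polyTwo n, ∃ R ∈ Moyal.moyalAlgebra n θ, ∀ a : 𝓢(Moyal.Space n, ℂ),
        Moyal.moyalMul n θ ⟨P, hP P.2⟩ ⟨Q, hP Q.2⟩ a = R a) ∧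
      (∃ B : Moyal.polyTwo n →ₗ[ℂ] Moyal.polyTwo n →ₗ[ℂ] Moyal.polyTwo n,
        Moyal.IsLieBracket B ∧
        ∀ (P Q : Moyal.polyTwo n) (a : 𝓢(Moyal.Space n, ℂ)),
          Moyal.moyalBracket n θ ⟨P, hP P.2⟩ ⟨Q, hP Q.2⟩ a =
            (B P Q : 𝓢'(Moyal.Space n, ℂ)) a) ∧
      ∀ (P Q : Moyal.polyTwo n) (p q : MvPolynomial (Fin 2 × Fin n) ℂ),
        Moyal.polyDist n p = P → Moyal.polyDist n q = Q →
        ∀ a : 𝓢(Moyal.Space n, ℂ),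
          Moyal.moyalBracket n θ ⟨P, hP P.2⟩ ⟨Q, hP Q.2⟩ a =
            Complex.I * Moyal.polyDist n (Moyal.poissonBracket n θ p q) a := by
  refine ⟨Moyal.polyTwo_le_moyalAlgebra n θ, fun P Q => ?_, ⟨Moyal.polyTwoBracket n θ,
    Moyal.isLieBracket_polyTwoBracket n θ, fun P Q a =>
      Moyal.moyalBracket_eq_polyTwoBracket P Q _ _ a⟩, fun P Q p q hp hq a => ?_⟩
  · obtain ⟨A, hA⟩ := Moyal.exists_represents θ P.2
    obtain ⟨A', hA'⟩ := Moyal.exists_represents (-θ) P.2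
    obtain ⟨B, hB⟩ := Moyal.exists_represents θ Q.2
    obtain ⟨B', hB'⟩ := Moyal.exists_represents (-θ) Q.2
    -- The witness for `P ⋆ Q` is `P` precomposed with the operator of `Q`.
    exact ⟨_, hA.comp_mem_moyalAlgebra hA' hB hB', fun a => hB.moyalMul_eq _ _ a⟩
  · rw [Moyal.moyalBracket_eq_smul_poissonBracket P Q p q hp hq, map_smul]
    rfl
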